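/- Let $P_1,P_2,N>0$. All rate pairs $(R_1,R_2)$ are nonnegative and $\log$ is the natural logarithm (rates in nats). \emph{Ozarow's rectangle.} For $\rho\in[0,1]$ let $\mathcal R_{\mathrm{Oz}}^{\rho}(P_1,P_2,N)$ be the set of rate pairs with $R_\nu\le\frac12\log\bigl(1+\frac{P_\nu(1-\rho^2)}{N}\bigr)$, $\nu=1,2$, and $R_1+R_2\le\frac12\log\bigl(1+\frac{P_1+P_2+2\sqrt{P_1P_2}\,\rho}{N}\bigr)$. Let $\rho^*$ be the unique solution in $[0,1]$ of $N(N+P_1+P_2+2\sqrt{P_1P_2}\,\rho)=(N+P_1(1-\rho^2))(N+P_2(1-\rho^2))$, and let $R^*=\bigl(\frac12\log(1+\frac{P_1(1-\rho^{*2})}{N}),\ \frac12\log(1+\frac{P_2(1-\rho^{*2})}{N})\bigr)$. \emph{The region $\mathcal R(P_1,P_2,N,K)$.} Let $K$ be a positive semidefinite real $2\times2$ matrix. For an integer $\eta\ge1$, vectors $a_1,a_2\in\mathbb R^\eta$, strictly lower-triangular $B_1,B_2\in\mathbb R^{\eta\times\eta}$ and $C\in\mathbb R^{2\times\eta}$ put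 $$A=(a_1\ a_2),\quad A_d=\begin{pmatrix}a_1&0\\0&a_2\end{pmatrix},\quad \bar B=(B_1\ B_2),\quad B_t=\begin{pmatrix}B_1\\B_2\end{pmatrix},\quad B_d=\begin{pmatrix}B_1&0\\0&B_2\end{pmatrix},\quad \mathbf B=\begin{pmatrix}B_1&B_1\\B_2&B_2\end{pmatrix},$$ $S=NI_\eta+\bar B(K\otimes I_\eta)\bar B^{T}$. If $CC^{T}$ is nonsingular, the region of $(\eta,a_1,a_2,B_1,B_2,C)$ is the set of rate pairs with $$R_\nu\le\frac1{2\eta}\log\frac{|C(a_\nu a_\nu^{T}+S)C^{T}|}{|CSC^{T}|}\ (\nu=1,2),\qquad R_1+R_2\le\frac1{2\eta}\log\frac{|C(AA^{T}+S)C^{T}|}{|CSC^{T}|};$$ if $CC^{T}$ is singular and $C\ne0$, $C$ is replaced here by one of its nonzero rows; if $C=0$ the region is $\{(0,0)\}$. Then $\mathcal R(P_1,P_2,N,K)$ is the closure of the union of these regions over all $(\eta,a_1,a_2,B_1,B_2,C)$ for which the two $\eta\times\eta$ diagonal blocks of $$(I_{2\eta}-\mathbf B)^{-1}\bigl(A_dA_d^{T}+N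 B_tB_t^{T}+B_d(K\otimes I_\eta)B_d^{T}\bigr)(I_{2\eta}-\mathbf B)^{-T}$$ have traces at most $\eta P_1$ and $\eta P_2$, respectively. \emph{Perfect-feedback capacity region.} Consider the channel $Y_t=X_{1,t}+X_{2,t}+Z_t$ with $Z_t$ i.i.d. $\mathcal N(0,N)$, where $X_{\nu,t}$ is a (measurable) function of the message $M_\nu$ and of $Y_1,\dots,Y_{t-1}$, the messages are independent of each other and of the noise and uniform on finite sets $\mathcal M_1,\mathcal M_2$, $\frac1n\sum_{t=1}^n\mathbb E[X_{\nu,t}^2]\le P_\nu$, and the receiver decodes $(M_1,M_2)$ from $Y_1,\dots,Y_n$. $\mathcal C_{\mathrm{PerfectFB}}(P_1,P_2,N)$ is the set of $(R_1,R_2)$ such that for every $\delta>0$ there are, for all sufficiently large $n$, codes of blocklength $n$ with $\frac1n\log|\mathcal M_\nu|>R_\nu-\delta$, $\nu=1,2$, whose average error probability tends to $0$ as $n\to\infty$. \textbf{Statement.} With $K$ ranging over positive semidefinite real $2\times 2$ matrices, $$\mathrm{cl}\Bigl(\ \bigcup_{\sigma>0}\ \bigcap_{K:\ \mathrm{tr}K\le\sigma^2}\mathcal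 R(P_1,P_2,N,K)\Bigr)\ \supseteq\ \mathcal R_{\mathrm{Oz}}^{\rho^*}(P_1,P_2,N).$$ Consequently the regions $\mathcal R(P_1,P_2,N,K)$ approach the point of maximum sum-rate of $\mathcal C_{\mathrm{PerfectFB}}(P_1,P_2,N)$ as the feedback-noise variances vanish, irrespective of the feedback-noise correlation: $R^*$ is the unique point of maximum sum-rate $R_1+R_2$ in $\mathcal C_{\mathrm{PerfectFB}}(P_1,P_2,N)$, and for every $\varepsilon>0$ there is $\sigma>0$ such that for every $K\succeq0$ with $\mathrm{tr}K\le\sigma^2$ the region $\mathcal R(P_1,P_2,N,K)$ contains a point at distance less than $\varepsilon$ from $R^*$. -/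

import Mathlib

open scoped Kronecker

noncomputable section

namespace AWGNMAC

/-! ### Ozarow's regions -/

/-- The quartic equation whose unique root in `[0,1]` is `ρ*`. -/
def RhoEquation (P₁ P₂ N ρ : ℝ) : Prop :=
  N * (N + P₁ + P₂ + 2 * √(P₁ * P₂) * ρ) =
    (N + P₁ * (1 - ρ ^ 2)) * (N + P₂ * (1 - ρ ^ 2))

/-- For positive parameters the quartic equation has exactly one solution in `[0,1]`. -/
theorem existsUnique_rhoEquation {P₁ P₂ N : ℝ} (h₁ : 0 < P₁) (h₂ : 0 < P₂) (hN : 0 < N) :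
    ∃! ρ : ℝ, ρ ∈ Set.Icc (0 : ℝ) 1 ∧ RhoEquation P₁ P₂ N ρ := by
  have hs : 0 < √(P₁ * P₂) := Real.sqrt_pos.2 (mul_pos h₁ h₂)
  have hmono : ∀ x y : ℝ, 0 ≤ x → x < y → y ≤ 1 →
      RhoEquation P₁ P₂ N x → RhoEquation P₁ P₂ N y → False := by
    intro x y hx hxy hy ex ey
    unfold RhoEquation at ex ey
    have hl : N * (N + P₁ + P₂ + 2 * √(P₁ * P₂) * x) <
        N * (N + P₁ + P₂ + 2 * √(P₁ * P₂) * y) := by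
      have : √(P₁ * P₂) * x < √(P₁ * P₂) * y := by gcongr
      exact mul_lt_mul_of_pos_left (by linarith) hN
    have hsq : x ^ 2 ≤ y ^ 2 := by gcongr
    have hy2 : 0 ≤ 1 - y ^ 2 := by nlinarith
    have hr : (N + P₁ * (1 - y ^ 2)) * (N + P₂ * (1 - y ^ 2)) ≤
        (N + P₁ * (1 - x ^ 2)) * (N + P₂ * (1 - x ^ 2)) := by
      have hx2 : 0 ≤ 1 - x ^ 2 := by linarith
      gcongr
    linarith
  let g : ℝ → ℝ := fun ρ => (N + P₁ * (1 - ρ ^ 2)) * (N + P₂ * (1 - ρ ^ 2)) -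
    N * (N + P₁ + P₂ + 2 * √(P₁ * P₂) * ρ)
  have hg : ContinuousOn g (Set.Icc 0 1) := by
    apply Continuous.continuousOn
    fun_prop
  have h0 : (0 : ℝ) ∈ Set.Icc (g 1) (g 0) := by
    constructor
    · simp only [g]; nlinarith [mul_pos hN h₁, mul_pos hN h₂, mul_pos hN hs]
    · simp only [g]; nlinarith [mul_pos h₁ h₂]
  obtain ⟨ρ, hρ, hρ0⟩ := intermediate_value_Icc' zero_le_one hg h0
  refine ⟨ρ, ⟨hρ, ?_⟩, ?_⟩
  · simp only [g] at hρ0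
    unfold RhoEquation
    linarith
  · rintro y ⟨hy, ey⟩
    have ex : RhoEquation P₁ P₂ N ρ := by
      simp only [g] at hρ0
      unfold RhoEquation
      linarith
    rcases lt_trichotomy y ρ with h | h | h
    · exact (hmono y ρ hy.1 h hρ.2 ey ex).elim
    · exact h
    · exact (hmono ρ y hρ.1 h hy.2 ex ey).elim

open Classical in
/-- `ρ*(P₁,P₂,N)`: the unique solution in `[0,1]` of the quartic equation
(which exists for positive parameters; a dummy value otherwise). -/
def rhoStar (P₁ P₂ N : ℝ) : ℝ :=
  if h : ∃! ρ : ℝ, ρ ∈ Set.Icc (0 : ℝ) 1 ∧ RhoEquation P₁ P₂ N ρ then h.choose else 0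

theorem rhoStar_spec {P₁ P₂ N : ℝ} (h₁ : 0 < P₁) (h₂ : 0 < P₂) (hN : 0 < N) :
    rhoStar P₁ P₂ N ∈ Set.Icc (0 : ℝ) 1 ∧ RhoEquation P₁ P₂ N (rhoStar P₁ P₂ N) := by
  have h := existsUnique_rhoEquation h₁ h₂ hN
  unfold rhoStar
  rw [dif_pos h]
  exact h.choose_spec.1

/-- Ozarow's region `R_Oz^ρ(P₁,P₂,N)`. -/
def ozarowRegion (P₁ P₂ N ρ : ℝ) : Set (ℝ × ℝ) :=
  {R | 0 ≤ R.1 ∧ 0 ≤ R.2 ∧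
    R.1 ≤ 1 / 2 * Real.log (1 + P₁ * (1 - ρ ^ 2) / N) ∧
    R.2 ≤ 1 / 2 * Real.log (1 + P₂ * (1 - ρ ^ 2) / N) ∧
    R.1 + R.2 ≤ 1 / 2 * Real.log (1 + (P₁ + P₂ + 2 * √(P₁ * P₂) * ρ) / N)}

/-- The dominant corner point of the rectangle `R_Oz^{ρ*}(P₁,P₂,N)`. -/
def ozarowCorner (P₁ P₂ N : ℝ) : ℝ × ℝ :=
  (1 / 2 * Real.log (1 + P₁ * (1 - rhoStar P₁ P₂ N ^ 2) / N),
    1 / 2 * Real.log (1 + P₂ * (1 - rhoStar P₁ P₂ N ^ 2) / N))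

/-! ### The regions of the concatenated scheme

The two transmitters are indexed by `Fin 2`; a vector of length `2η` is indexed by
`Fin 2 × Fin η` (transmitter first), so that block matrices are indexed in the same way as the
Kronecker product `K ⊗ₖ I_η`. -/

section Concatenated

variable {η : ℕ}

/-- The `η × 2` matrix `(a₁ a₂)`. -/
def aRow (a : Fin 2 → Fin η → ℝ) : Matrix (Fin η) (Fin 2) ℝ :=
  Matrix.of fun i ν => a ν i

/-- The `2η × 2` block-diagonal matrix with diagonal blocks `a₁`, `a₂`. -/
def aDiag (a : Fin 2 → Fin η → ℝ) : Matrix (Fin 2 × Fin η) (Fin 2) ℝ :=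
  Matrix.of fun p ν => if p.1 = ν then a ν p.2 else 0

/-- The `η × 2η` matrix `(B₁ B₂)`. -/
def bRow (B : Fin 2 → Matrix (Fin η) (Fin η) ℝ) : Matrix (Fin η) (Fin 2 × Fin η) ℝ :=
  Matrix.of fun i q => B q.1 i q.2

/-- The `2η × η` matrix with `B₁` on top of `B₂`. -/
def bCol (B : Fin 2 → Matrix (Fin η) (Fin η) ℝ) : Matrix (Fin 2 × Fin η) (Fin η) ℝ :=
  Matrix.of fun p j => B p.1 p.2 j

/-- The `2η × 2η` block-diagonal matrix with diagonal blocks `B₁`, `B₂`. -/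
def bDiag (B : Fin 2 → Matrix (Fin η) (Fin η) ℝ) :
    Matrix (Fin 2 × Fin η) (Fin 2 × Fin η) ℝ :=
  Matrix.of fun p q => if p.1 = q.1 then B p.1 p.2 q.2 else 0

/-- The `2η × 2η` matrix with block rows `(B₁ B₁)` and `(B₂ B₂)`. -/
def bFull (B : Fin 2 → Matrix (Fin η) (Fin η) ℝ) :
    Matrix (Fin 2 × Fin η) (Fin 2 × Fin η) ℝ :=
  Matrix.of fun p q => B p.1 p.2 q.2

/-- The effective noise covariance `N I_η + (B₁ B₂)(K ⊗ I_η)(B₁ B₂)ᵀ`. -/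
def noiseCov (N : ℝ) (K : Matrix (Fin 2) (Fin 2) ℝ) (B : Fin 2 → Matrix (Fin η) (Fin η) ℝ) :
    Matrix (Fin η) (Fin η) ℝ :=
  N • (1 : Matrix (Fin η) (Fin η) ℝ) +
    bRow B * (K ⊗ₖ (1 : Matrix (Fin η) (Fin η) ℝ)) * (bRow B).transpose

/-- `(1/(2η)) log (|C (S + T) Cᵀ| / |C T Cᵀ|)`, with signal covariance `S` and
noise covariance `T`. -/
def logDetRate {ι : Type} [Fintype ι] [DecidableEq ι] (C : Matrix ι (Fin η) ℝ)
    (S T : Matrix (Fin η) (Fin η) ℝ) : ℝ :=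
  1 / (2 * (η : ℝ)) *
    Real.log ((C * (S + T) * C.transpose).det / (C * T * C.transpose).det)

/-- The nonnegative rate pairs that satisfy the three rate constraints for a decoding
matrix `C` (with two rows or with one row). -/
def rateSet {ι : Type} [Fintype ι] [DecidableEq ι] (N : ℝ) (K : Matrix (Fin 2) (Fin 2) ℝ)
    (a : Fin 2 → Fin η → ℝ) (B : Fin 2 → Matrix (Fin η) (Fin η) ℝ)
    (C : Matrix ι (Fin η) ℝ) : Set (ℝ × ℝ) :=
  {R | 0 ≤ R.1 ∧ 0 ≤ R.2 ∧
    R.1 ≤ logDetRate C (Matrix.vecMulVec (a 0) (a 0)) (noiseCov N K B) ∧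
    R.2 ≤ logDetRate C (Matrix.vecMulVec (a 1) (a 1)) (noiseCov N K B) ∧
    R.1 + R.2 ≤ logDetRate C (aRow a * (aRow a).transpose) (noiseCov N K B)}

/-- The region `R(N, K; η, a₁, a₂, B₁, B₂, C)`. If `C Cᵀ` is singular and `C ≠ 0`, then `C` is
replaced by one of its nonzero rows (these are proportional, so all choices agree); if `C = 0`
the region is the origin. -/
def schemeRegion (N : ℝ) (K : Matrix (Fin 2) (Fin 2) ℝ)
    (a : Fin 2 → Fin η → ℝ) (B : Fin 2 → Matrix (Fin η) (Fin η) ℝ)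
    (C : Matrix (Fin 2) (Fin η) ℝ) : Set (ℝ × ℝ) :=
  {R | (IsUnit (C * C.transpose).det ∧ R ∈ rateSet N K a B C) ∨
    (¬ IsUnit (C * C.transpose).det ∧
      ∃ i : Fin 2, C i ≠ 0 ∧ R ∈ rateSet N K a B (Matrix.replicateRow (Fin 1) (C i))) ∨
    (C = 0 ∧ R = 0)}

/-- The second-moment matrix of the `2η` channel inputs of one block,
`(I - B)⁻¹ (A Aᵀ + N B̃ B̃ᵀ + D (K ⊗ I) Dᵀ) (I - B)⁻ᵀ`. -/
def inputCov (N : ℝ) (K : Matrix (Fin 2) (Fin 2) ℝ)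
    (a : Fin 2 → Fin η → ℝ) (B : Fin 2 → Matrix (Fin η) (Fin η) ℝ) :
    Matrix (Fin 2 × Fin η) (Fin 2 × Fin η) ℝ :=
  (1 - bFull B)⁻¹ *
    (aDiag a * (aDiag a).transpose + N • (bCol B * (bCol B).transpose) +
      bDiag B * (K ⊗ₖ (1 : Matrix (Fin η) (Fin η) ℝ)) * (bDiag B).transpose) *
    ((1 - bFull B)⁻¹).transpose

/-- The trace of the diagonal block of the input covariance that belongs to transmitter `ν`. -/
def inputPower (N : ℝ) (K : Matrix (Fin 2) (Fin 2) ℝ)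
    (a : Fin 2 → Fin η → ℝ) (B : Fin 2 → Matrix (Fin η) (Fin η) ℝ) (ν : Fin 2) : ℝ :=
  ((inputCov N K a B).submatrix (fun i => (ν, i)) (fun i => (ν, i))).trace

end Concatenated

/-- The rate region `R(P₁,P₂,N,K)` of the concatenated scheme. -/
def rateRegion (P₁ P₂ N : ℝ) (K : Matrix (Fin 2) (Fin 2) ℝ) : Set (ℝ × ℝ) :=
  closure {R | ∃ (η : ℕ) (a : Fin 2 → Fin η → ℝ) (B : Fin 2 → Matrix (Fin η) (Fin η) ℝ)
    (C : Matrix (Fin 2) (Fin η) ℝ),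
    0 < η ∧
    (∀ (ν : Fin 2) (i j : Fin η), i ≤ j → B ν i j = 0) ∧
    inputPower N K a B 0 ≤ (η : ℝ) * P₁ ∧
    inputPower N K a B 1 ≤ (η : ℝ) * P₂ ∧
    R ∈ schemeRegion N K a B C}

/-- The set `⋃_{σ > 0} ⋂_{K : tr K ≤ σ²} R(P₁,P₂,N,K)`; `K` ranges over covariance
matrices. -/
def vanishingNoiseRegion (P₁ P₂ N : ℝ) : Set (ℝ × ℝ) :=
  ⋃ σ ∈ Set.Ioi (0 : ℝ),
    ⋂ K ∈ {K : Matrix (Fin 2) (Fin 2) ℝ | K.PosSemidef ∧ K.trace ≤ σ ^ 2},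
      rateRegion P₁ P₂ N K

/-! ### The capacity region of the AWGN MAC with perfect feedback -/

/-- The encoders and the decoder of a blocklength-`n` code for the two-user MAC with perfect
feedback. At time `t` (counted from `0`) each encoder sees its message and the `t` previous
channel outputs. -/
structure FeedbackCode (n : ℕ) where
  /-- number of messages of transmitter 1 -/
  M₁ : ℕ
  /-- number of messages of transmitter 2 -/
  M₂ : ℕ
  enc₁ : (t : Fin n) → Fin M₁ → (Fin t → ℝ) → ℝ
  enc₂ : (t : Fin n) → Fin M₂ → (Fin t → ℝ) → ℝ
  dec : (Fin n → ℝ) → Fin M₁ × Fin M₂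
  measurable_enc₁ : ∀ t m, Measurable (enc₁ t m)
  measurable_enc₂ : ∀ t m, Measurable (enc₂ t m)
  measurable_dec : Measurable dec

namespace FeedbackCode

variable {n : ℕ}

/-- The first `t` channel outputs when the messages are `m₁`, `m₂` and the noise is `z`:
`Y_s = X_{1,s} + X_{2,s} + z_s`. -/
def output (c : FeedbackCode n) (m₁ : Fin c.M₁) (m₂ : Fin c.M₂) (z : Fin n → ℝ) :
    (t : ℕ) → t ≤ n → Fin t → ℝ
  | 0, _ => Fin.elim0
  | t + 1, h =>
    Fin.snoc (α := fun _ => ℝ) (c.output m₁ m₂ z t (Nat.le_of_succ_le h))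
      (c.enc₁ ⟨t, h⟩ m₁ (c.output m₁ m₂ z t (Nat.le_of_succ_le h)) +
        c.enc₂ ⟨t, h⟩ m₂ (c.output m₁ m₂ z t (Nat.le_of_succ_le h)) + z ⟨t, h⟩)

/-- The time-`t` channel input of transmitter 1. -/
def input₁ (c : FeedbackCode n) (m₁ : Fin c.M₁) (m₂ : Fin c.M₂) (z : Fin n → ℝ)
    (t : Fin n) : ℝ :=
  c.enc₁ t m₁ (c.output m₁ m₂ z t t.isLt.le)

/-- The time-`t` channel input of transmitter 2. -/
def input₂ (c : FeedbackCode n) (m₁ : Fin c.M₁) (m₂ : Fin c.M₂) (z : Fin n → ℝ)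
    (t : Fin n) : ℝ :=
  c.enc₂ t m₂ (c.output m₁ m₂ z t t.isLt.le)

end FeedbackCode

/-- The law of `n` i.i.d. centred Gaussians of variance `N`. -/
def noiseLaw (n : ℕ) (N : ℝ) : MeasureTheory.Measure (Fin n → ℝ) :=
  MeasureTheory.Measure.pi fun _ => ProbabilityTheory.gaussianReal 0 N.toNNReal

namespace FeedbackCode

variable {n : ℕ}

/-- The average block-power constraint `(1/n) ∑ₜ E[Xₜ²] ≤ P` on channel inputs `X`; the
expectation is over independent uniform messages and the noise. -/
def PowerConstraint (c : FeedbackCode n) (N P : ℝ)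
    (X : Fin c.M₁ → Fin c.M₂ → (Fin n → ℝ) → Fin n → ℝ) : Prop :=
  (∀ m₁ m₂ t, MeasureTheory.Integrable (fun z => X m₁ m₂ z t ^ 2) (noiseLaw n N)) ∧
  1 / (n : ℝ) * ∑ t, (1 / ((c.M₁ : ℝ) * c.M₂) *
    ∑ m₁, ∑ m₂, ∫ z, X m₁ m₂ z t ^ 2 ∂(noiseLaw n N)) ≤ P

/-- The average probability of a decoding error. -/
def errorProb (c : FeedbackCode n) (N : ℝ) : ℝ :=
  1 / ((c.M₁ : ℝ) * c.M₂) * ∑ m₁, ∑ m₂,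
    (noiseLaw n N).real {z | c.dec (c.output m₁ m₂ z n le_rfl) ≠ (m₁, m₂)}

end FeedbackCode

/-- The capacity region of the AWGN MAC with perfect feedback: the set of all achievable
(nonnegative) rate pairs, in nats per channel use. -/
def perfectFeedbackCapacity (P₁ P₂ N : ℝ) : Set (ℝ × ℝ) :=
  {R | 0 ≤ R.1 ∧ 0 ≤ R.2 ∧ ∀ δ > (0 : ℝ), ∀ ε > (0 : ℝ), ∀ᶠ n : ℕ in Filter.atTop,
    ∃ c : FeedbackCode n,
      c.PowerConstraint N P₁ c.input₁ ∧ c.PowerConstraint N P₂ c.input₂ ∧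
      R.1 - δ < 1 / (n : ℝ) * Real.log c.M₁ ∧ R.2 - δ < 1 / (n : ℝ) * Real.log c.M₂ ∧
      c.errorProb N ≤ ε}

end AWGNMAC

end

open scoped Kronecker

noncomputable section

namespace AWGNMAC

/-! ### The correlation coefficient `ρ*` -/

/-! Everything rests on Ozarow's linear scheme at ρ*, read as a recursion for a 2×2 matrix. Let each
transmitter send an amplitude times the error of the linear MMSE estimate of its message. The error
covariance before slot t is then J⁻¹, where J = I + Gram/N is formed from the amplitudes used before
t (`linearPower_mmseGain`). Put λ_ν = 1 + P_ν(1-ρ²)/N. The amplitudes grow like √λ_ν, and one of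
them alternates in sign. The quartic is what makes the off-diagonal entry of J keep the modulus
ρ√(J₀₀J₁₁) while J_νν is multiplied by λ_ν (`RhoEquation.gain_identity`). So every active slot after
the first costs exactly P_ν, and a fixed number of idle slots pays for the first one
(`exists_linearScheme`). For the matched filter C = Aᵀ the three log-determinants reduce to log J₀₀,
log J₁₁ and log det J. Since det J = (1-ρ²)J₀₀J₁₁, the sum constraint costs nothing in the limit and
the whole rectangle is approached.

Feedback noise enters only by continuity. A block is fixed for which all power and rate inequalities
are strict at K = 0, and they persist near 0. A positive semidefinite K of small trace is close to 0
whatever its correlation (`mem_rateRegion_of_lt`).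

The converse is Ozarow's outer bound, proved by change of measure instead of mutual information. The
output law is compared with a causal Gaussian law whose innovation is αX₁ + βX₂ + Z
(`FeedbackCode.fano`). Suitable α and β give the three bounds with a common ρ
(`FeedbackCode.outer_bound`). The sum bound increases in ρ, the individual bounds decrease, and they
meet at ρ*, so only the corner can attain the maximal sum-rate.

That the corner is achievable with perfect feedback follows from the same linear scheme with
pulse-amplitude modulated messages, zero-forcing estimates and Chebyshev's inequality
(`ozarowCorner_mem_capacity`). -/

theorem rhoEquation_pos_lt_one {P₁ P₂ N ρ : ℝ} (h₁ : 0 < P₁) (h₂ : 0 < P₂) (hN : 0 < N)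
    (hρ : ρ ∈ Set.Icc (0 : ℝ) 1) (h : RhoEquation P₁ P₂ N ρ) : 0 < ρ ∧ ρ < 1 := by
  have hs : 0 < √(P₁ * P₂) := Real.sqrt_pos.2 (mul_pos h₁ h₂)
  unfold RhoEquation at h
  constructor
  · refine lt_of_le_of_ne hρ.1 ?_
    rintro rfl
    nlinarith [mul_pos h₁ h₂]
  · refine lt_of_le_of_ne hρ.2 ?_
    rintro rfl
    nlinarith [mul_pos hN h₁, mul_pos hN h₂, mul_pos hN hs]

/-- At `ρ*` one step of the recursion flips the sign of the correlation and keeps its modulus. -/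
theorem RhoEquation.gain_identity {P₁ P₂ N ρ : ℝ} (h₁ : 0 < P₁) (h₂ : 0 < P₂) (hN : 0 < N)
    (hρ : 0 < ρ) (hρ1 : ρ < 1) (h : RhoEquation P₁ P₂ N ρ) :
    √(P₁ * P₂) * (1 - ρ ^ 2) / N =
      ρ * (1 + √((1 + P₁ * (1 - ρ ^ 2) / N) * (1 + P₂ * (1 - ρ ^ 2) / N))) := by
  have hs : 0 < √(P₁ * P₂) := Real.sqrt_pos.2 (mul_pos h₁ h₂)
  have hs2 : √(P₁ * P₂) ^ 2 = P₁ * P₂ := Real.sq_sqrt (mul_pos h₁ h₂).le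
  have hτ : 0 < 1 - ρ ^ 2 := by nlinarith
  unfold RhoEquation at h
  set s := √(P₁ * P₂)
  have hl1 : 0 < 1 + P₁ * (1 - ρ ^ 2) / N := by positivity
  have hl2 : 0 < 1 + P₂ * (1 - ρ ^ 2) / N := by positivity
  have hq := Real.sq_sqrt (mul_pos hl1 hl2).le
  have hqp := Real.sqrt_pos.2 (mul_pos hl1 hl2)
  have hq1 : 1 ≤ √((1 + P₁ * (1 - ρ ^ 2) / N) * (1 + P₂ * (1 - ρ ^ 2) / N)) := by
    rw [Real.one_le_sqrt]
    have a1 : 0 ≤ P₁ * (1 - ρ ^ 2) / N := by positivity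
    have a2 : 0 ≤ P₂ * (1 - ρ ^ 2) / N := by positivity
    nlinarith [mul_nonneg a1 a2]
  set q := √((1 + P₁ * (1 - ρ ^ 2) / N) * (1 + P₂ * (1 - ρ ^ 2) / N))
  set κ := s * (1 - ρ ^ 2) / N with hκ
  have hκp : 0 < κ := by positivity
  -- `e1` expands the product of the two growth factors and `e2` evaluates it by the quartic.
  -- Eliminating κ² between them yields (κ-ρ)² = (ρq)².
  have e1 : q ^ 2 = 1 + (P₁ + P₂) * (1 - ρ ^ 2) / N + κ ^ 2 := by
    rw [hq, hκ, div_pow, mul_pow, hs2]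
    field_simp
    ring
  have e2 : q ^ 2 = 1 + (P₁ + P₂) / N + 2 * s * ρ / N := by
    rw [hq]
    field_simp
    linarith
  have e3 : (κ - ρ) ^ 2 = (ρ * q) ^ 2 := by
    have e4 : κ * ρ = s * ρ / N - ρ ^ 2 * (s * ρ / N) := by rw [hκ]; field_simp
    have e5 : (P₁ + P₂) * (1 - ρ ^ 2) / N = (P₁ + P₂) / N - ρ ^ 2 * ((P₁ + P₂) / N) := by
      field_simp
    have e6 : 2 * s * ρ / N = 2 * (s * ρ / N) := by ring
    rw [e5] at e1
    rw [e6] at e2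
    have e7 : κ ^ 2 = ρ ^ 2 * ((P₁ + P₂) / N) + 2 * (s * ρ / N) := by linarith
    rw [mul_pow, e2]
    linear_combination e7 - 2 * e4
  -- The negative root would give κ = ρ(1-q) ≤ 0, contradicting κ > 0.
  rcases sq_eq_sq_iff_eq_or_eq_neg.1 e3 with h | h
  · linarith
  · nlinarith

/-! ### Ozarow's amplitude sequence -/

/-- The amplitude with which a transmitter of power `p` and sign `s` sends its message at time `t`
in Ozarow's scheme. -/
def amplitude (N ρ p s : ℝ) : ℕ → ℝ
  | 0 => √(N * ρ / (1 - ρ))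
  | t + 1 => s ^ (t + 1) * √(p * (1 - ρ ^ 2) / (1 - ρ)) * √(1 + p * (1 - ρ ^ 2) / N) ^ t

theorem amplitude_zero_sq {N ρ p s : ℝ} (hN : 0 < N) (hρ : 0 < ρ) (hρ1 : ρ < 1) :
    amplitude N ρ p s 0 ^ 2 = N * ρ / (1 - ρ) := by
  have : 0 < 1 - ρ := by linarith
  simp only [amplitude]
  exact Real.sq_sqrt (by positivity)

theorem amplitude_succ_sq {N ρ p s : ℝ} (hN : 0 < N) (hρ : 0 < ρ) (hρ1 : ρ < 1) (hp : 0 < p)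
    (hs : s ^ 2 = 1) (t : ℕ) : amplitude N ρ p s (t + 1) ^ 2 =
      p * (1 - ρ ^ 2) / (1 - ρ) * (1 + p * (1 - ρ ^ 2) / N) ^ t := by
  have h1 : 0 < 1 - ρ := by linarith
  have hτ : 0 < 1 - ρ ^ 2 := by nlinarith
  simp only [amplitude]
  rw [mul_pow, mul_pow, ← pow_mul, mul_comm (t + 1) 2, pow_mul, hs, one_pow, ← pow_mul,
    mul_comm t 2, pow_mul, Real.sq_sqrt (by positivity), Real.sq_sqrt (by positivity), one_mul]

/-- The first amplitude starts the sum at 1/(1-ρ). Each later square, divided by N, is λ-1 times the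
value reached so far, where λ is the growth factor. -/
theorem one_add_sum_amplitude_sq {N ρ p s : ℝ} (hN : 0 < N) (hρ : 0 < ρ) (hρ1 : ρ < 1)
    (hp : 0 < p) (hs : s ^ 2 = 1) (t : ℕ) :
    1 + (∑ i ∈ Finset.range (t + 1), amplitude N ρ p s i * amplitude N ρ p s i) / N =
      (1 + p * (1 - ρ ^ 2) / N) ^ t / (1 - ρ) := by
  have h1 : 1 - ρ ≠ 0 := by linarith
  induction t with
  | zero =>
    simp only [zero_add, Finset.sum_range_one, pow_zero]
    rw [← sq, amplitude_zero_sq hN hρ hρ1]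
    field_simp
    ring
  | succ t ih =>
    rw [Finset.sum_range_succ, add_div, ← add_assoc, ih, ← sq,
      amplitude_succ_sq hN hρ hρ1 hp hs,
      pow_succ (1 + p * (1 - ρ ^ 2) / N) t]
    generalize (1 + p * (1 - ρ ^ 2) / N) ^ t = x
    field_simp

/-- Each new product has the sign opposite to the accumulated sum and, by the gain identity, 1+q
times its modulus. So the sum changes sign and its modulus is multiplied by q = √(λ₁λ₂). -/
theorem sum_amplitude_mul {N ρ P₁ P₂ : ℝ} (h₁ : 0 < P₁) (h₂ : 0 < P₂) (hN : 0 < N)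
    (hρ : 0 < ρ) (hρ1 : ρ < 1) (h : RhoEquation P₁ P₂ N ρ) (t : ℕ) :
    (∑ i ∈ Finset.range (t + 1), amplitude N ρ P₁ 1 i * amplitude N ρ P₂ (-1) i) / N =
      (-1) ^ t * ρ *
        √((1 + P₁ * (1 - ρ ^ 2) / N) * (1 + P₂ * (1 - ρ ^ 2) / N)) ^ t / (1 - ρ) := by
  have h1 : 0 < 1 - ρ := by linarith
  have hτ : 0 < 1 - ρ ^ 2 := by nlinarith
  have hk := h.gain_identity h₁ h₂ hN hρ hρ1
  induction t with
  | zero =>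
    simp only [zero_add, Finset.sum_range_one, pow_zero, amplitude]
    rw [Real.mul_self_sqrt (by positivity)]
    field_simp
  | succ t ih =>
    rw [Finset.sum_range_succ, add_div, ih]
    simp only [amplitude, one_pow, one_mul]
    have e : √(P₁ * (1 - ρ ^ 2) / (1 - ρ)) * √(P₂ * (1 - ρ ^ 2) / (1 - ρ)) =
        √(P₁ * P₂) * (1 - ρ ^ 2) / (1 - ρ) := by
      rw [← Real.sqrt_mul (by positivity), show P₁ * (1 - ρ ^ 2) / (1 - ρ) *
        (P₂ * (1 - ρ ^ 2) / (1 - ρ)) = P₁ * P₂ * ((1 - ρ ^ 2) / (1 - ρ)) ^ 2 by ring,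
        Real.sqrt_mul (by positivity), Real.sqrt_sq (by positivity)]
      ring
    have e2 : √(1 + P₁ * (1 - ρ ^ 2) / N) ^ t * √(1 + P₂ * (1 - ρ ^ 2) / N) ^ t =
        √((1 + P₁ * (1 - ρ ^ 2) / N) * (1 + P₂ * (1 - ρ ^ 2) / N)) ^ t := by
      rw [← mul_pow, Real.sqrt_mul (by positivity)]
    set q := √((1 + P₁ * (1 - ρ ^ 2) / N) * (1 + P₂ * (1 - ρ ^ 2) / N))
    have e3 : √(P₁ * (1 - ρ ^ 2) / (1 - ρ)) * √(1 + P₁ * (1 - ρ ^ 2) / N) ^ t *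
        ((-1) ^ (t + 1) * √(P₂ * (1 - ρ ^ 2) / (1 - ρ)) * √(1 + P₂ * (1 - ρ ^ 2) / N) ^ t) / N =
        (-1) ^ (t + 1) * (√(P₁ * P₂) * (1 - ρ ^ 2) / N) / (1 - ρ) * q ^ t := by
      rw [← e2]
      calc _ = (-1) ^ (t + 1) * (√(P₁ * (1 - ρ ^ 2) / (1 - ρ)) *
            √(P₂ * (1 - ρ ^ 2) / (1 - ρ))) / N * (√(1 + P₁ * (1 - ρ ^ 2) / N) ^ t *
            √(1 + P₂ * (1 - ρ ^ 2) / N) ^ t) := by ring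
        _ = _ := by rw [e]; ring
    rw [e3, hk]
    ring

/-! ### Linear feedback schemes with perfect feedback -/

section Linear

variable {η : ℕ}

/-- The feedback matrices `B_ν` for which the inputs are `a_ν ξ_ν + F_ν (A ξ + Z)`. -/
def feedbackMatrix (F : Fin 2 → Matrix (Fin η) (Fin η) ℝ) (ν : Fin 2) :
    Matrix (Fin η) (Fin η) ℝ :=
  F ν * (1 + (F 0 + F 1))⁻¹

/-- The power of transmitter `ν` when it sends `a_ν ξ_ν + F_ν (A ξ + Z)`. -/
def linearPower (N : ℝ) (a : Fin 2 → Fin η → ℝ) (F : Fin 2 → Matrix (Fin η) (Fin η) ℝ)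
    (ν : Fin 2) : ℝ :=
  ∑ t, (∑ μ, ((if ν = μ then a μ t else 0) + ∑ s, F ν t s * a μ s) ^ 2 +
    N * ∑ s, F ν t s ^ 2)

theorem isUnit_det_one_add {F : Matrix (Fin η) (Fin η) ℝ} (hF : ∀ i j, i ≤ j → F i j = 0) :
    IsUnit (1 + F).det := by
  rw [Matrix.det_of_isLowerTriangular]
  · simp [hF]
  · intro i j hij
    have hij : i < j := by simpa using hij
    simp [hF i j hij.le, hij.ne]

theorem feedbackMatrix_strictLower {F : Fin 2 → Matrix (Fin η) (Fin η) ℝ}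
    (hF : ∀ ν i j, i ≤ j → F ν i j = 0) (ν : Fin 2) {i j : Fin η} (hij : i ≤ j) :
    feedbackMatrix F ν i j = 0 := by
  have hS : ∀ i j, i ≤ j → (F 0 + F 1) i j = 0 := fun i j h => by simp [hF _ i j h]
  have hu := isUnit_det_one_add hS
  have hl : ((1 + (F 0 + F 1))⁻¹).BlockTriangular OrderDual.toDual := by
    have := ((1 + (F 0 + F 1)).isUnit_iff_isUnit_det.2 hu).invertible
    apply Matrix.blockTriangular_inv_of_blockTriangular
    intro i j hij
    have hij : i < j := by simpa using hij
    simp [hF _ i j hij.le, hij.ne]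
  rw [feedbackMatrix, Matrix.mul_apply]
  refine Finset.sum_eq_zero fun k _ => ?_
  by_cases hk : i ≤ k
  · rw [hF ν i k hk, zero_mul]
  · rw [hl (show OrderDual.toDual j < OrderDual.toDual k from ?_), mul_zero]
    exact OrderDual.toDual_lt_toDual.2 ((not_le.1 hk).trans_le hij)

/-- With V = Aξ + Z and F = F₀ + F₁ the output is Y = (1+F)V. Hence feeding back B_ν Y amounts to
adding F_ν V, and 1 - (B₀+B₁) recovers V from Y. -/
theorem one_sub_feedbackMatrix {F : Fin 2 → Matrix (Fin η) (Fin η) ℝ}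
    (hF : ∀ ν i j, i ≤ j → F ν i j = 0) :
    (1 - (feedbackMatrix F 0 + feedbackMatrix F 1)) * (1 + (F 0 + F 1)) = 1 ∧
      ∀ ν, feedbackMatrix F ν * (1 + (F 0 + F 1)) = F ν := by
  have hu := isUnit_det_one_add (F := F 0 + F 1) fun i j h => by simp [hF _ i j h]
  have h3 : ∀ ν, feedbackMatrix F ν * (1 + (F 0 + F 1)) = F ν := fun ν => by
    rw [feedbackMatrix, Matrix.mul_assoc, Matrix.nonsing_inv_mul _ hu, Matrix.mul_one]
  have h1 : (1 - (feedbackMatrix F 0 + feedbackMatrix F 1)) * (1 + (F 0 + F 1)) = 1 := by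
    rw [Matrix.sub_mul, Matrix.add_mul, h3, h3]
    simp
  exact ⟨h1, h3⟩

/-- In terms of F the inverse of 1 - `bFull B` is simply 1 + `bFull F`. The covariance block then
becomes a sum of squared coefficients of ξ and Z. -/
theorem inputPower_feedbackMatrix (N : ℝ) (a : Fin 2 → Fin η → ℝ)
    {F : Fin 2 → Matrix (Fin η) (Fin η) ℝ} (hF : ∀ ν i j, i ≤ j → F ν i j = 0) (ν : Fin 2) :
    inputPower N 0 a (feedbackMatrix F) ν = linearPower N a F ν := by
  obtain ⟨-, h3⟩ := one_sub_feedbackMatrix hF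
  set B := feedbackMatrix F with hB
  have hinv : (1 - bFull B) * (1 + bFull F) = 1 := by
    have e : bFull B * bFull F + bFull B = bFull F := by
      ext ⟨μ, i⟩ ⟨κ, j⟩
      have e1 := congrFun (congrFun (h3 μ) i) j
      rw [Matrix.mul_add, Matrix.mul_add, Matrix.mul_one] at e1
      simp only [Matrix.add_apply, Matrix.mul_apply] at e1
      simp only [Matrix.add_apply, Matrix.mul_apply, bFull, Matrix.of_apply,
        Fintype.sum_prod_type, Fin.sum_univ_two]
      linarith
    rw [Matrix.sub_mul, Matrix.one_mul, Matrix.mul_add (bFull B), Matrix.mul_one,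
      add_comm (bFull B), e]
    simp
  have hI : (1 - bFull B)⁻¹ = 1 + bFull F := Matrix.inv_eq_right_inv hinv
  have hC : (1 - bFull B)⁻¹ * bCol B = bCol F := by
    have : (1 - bFull B) * bCol F = bCol B := by
      ext ⟨μ, i⟩ j
      have e1 := congrFun (congrFun (h3 μ) i) j
      rw [Matrix.mul_add, Matrix.mul_add, Matrix.mul_one] at e1
      simp only [Matrix.add_apply, Matrix.mul_apply] at e1
      rw [Matrix.sub_mul, Matrix.one_mul, Matrix.sub_apply, Matrix.mul_apply]
      simp only [bFull, bCol, Matrix.of_apply, Fintype.sum_prod_type, Fin.sum_univ_two]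
      linarith
    rw [← this, hI, ← Matrix.mul_assoc, mul_eq_one_comm.1 hinv, Matrix.one_mul]
  have hA : ∀ t μ, ((1 - bFull B)⁻¹ * aDiag a) (ν, t) μ =
      (if ν = μ then a μ t else 0) + ∑ s, F ν t s * a μ s := by
    intro t μ
    rw [hI, Matrix.add_mul, Matrix.one_mul]
    simp only [Matrix.add_apply, aDiag, Matrix.of_apply, Matrix.mul_apply, bFull,
      Fintype.sum_prod_type, Fin.sum_univ_two]
    congr 1
    fin_cases μ <;> simp
  have hcov : inputCov N 0 a B = ((1 - bFull B)⁻¹ * aDiag a) *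
      ((1 - bFull B)⁻¹ * aDiag a).transpose + N • (bCol F * (bCol F).transpose) := by
    rw [inputCov, Matrix.zero_kronecker, Matrix.mul_zero, Matrix.zero_mul, add_zero, ← hC,
      Matrix.transpose_mul, Matrix.transpose_mul]
    simp only [Matrix.mul_add, Matrix.add_mul, Matrix.mul_assoc, Matrix.smul_mul, Matrix.mul_smul]
  rw [inputPower, hcov, linearPower, Matrix.trace]
  refine Finset.sum_congr rfl fun t _ => ?_
  simp only [Matrix.diag_apply, Matrix.submatrix_apply, Matrix.add_apply, Matrix.smul_apply,
    Matrix.mul_apply (M := (1 - bFull B)⁻¹ * aDiag a), Matrix.transpose_apply, hA,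
    Matrix.mul_apply (M := bCol F), smul_eq_mul, sq]
  rfl

/-- `I + Gram/N` for the first `t` amplitudes. -/
def information (N : ℝ) (a : Fin 2 → Fin η → ℝ) (t : Fin η) : Matrix (Fin 2) (Fin 2) ℝ :=
  Matrix.of fun μ κ => (if μ = κ then 1 else 0) + (∑ s, if s < t then a μ s * a κ s else 0) / N

/-- The feedback gains that subtract the linear MMSE estimate from the message. -/
def mmseGain (N : ℝ) (a : Fin 2 → Fin η → ℝ) (ν : Fin 2) : Matrix (Fin η) (Fin η) ℝ :=
  Matrix.of fun t s =>
    if s < t then -(a ν t / N) * ∑ μ, (information N a t)⁻¹ μ ν * a μ s else 0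

theorem mmseGain_strictLower (N : ℝ) (a : Fin 2 → Fin η → ℝ) (ν : Fin 2) (i j : Fin η)
    (hij : i ≤ j) : mmseGain N a ν i j = 0 := by
  simp [mmseGain, not_lt.2 hij]

/-- Let w be column ν of J⁻¹ and G the Gram matrix of the past amplitudes. From Jw = e_ν the
coefficients of the error on the messages are e_ν - (G/N)w = w, and the noise contributes wᵀ(G/N)w.
The total is wᵀJw = w_ν. -/
theorem linearPower_mmseGain {N : ℝ} (hN : 0 < N) (a : Fin 2 → Fin η → ℝ)
    (hdet : ∀ t, (information N a t).det ≠ 0) (ν : Fin 2) :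
    linearPower N a (mmseGain N a) ν = ∑ t, a ν t ^ 2 * (information N a t)⁻¹ ν ν := by
  refine Finset.sum_congr rfl fun t _ => ?_
  have hJ := Matrix.mul_nonsing_inv _ (isUnit_iff_ne_zero.2 (hdet t))
  set w := (information N a t)⁻¹ with hw
  set G : Fin 2 → Fin 2 → ℝ := fun μ κ => ∑ s, if s < t then a μ s * a κ s else 0 with hG
  have hGs : G 1 0 = G 0 1 := by simp only [hG, mul_comm (a 1 _)]
  have hc : ∀ μ, ∑ s, mmseGain N a ν t s * a μ s =
      -(a ν t / N) * (w 0 ν * G 0 μ + w 1 ν * G 1 μ) := by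
    intro μ
    simp only [hG, Finset.mul_sum, ← Finset.sum_add_distrib]
    refine Finset.sum_congr rfl fun s _ => ?_
    simp only [mmseGain, Matrix.of_apply, Fin.sum_univ_two]
    split_ifs <;> ring
  have hq : ∑ s, mmseGain N a ν t s ^ 2 = (a ν t / N) ^ 2 *
      (w 0 ν ^ 2 * G 0 0 + 2 * (w 0 ν * w 1 ν * G 0 1) + w 1 ν ^ 2 * G 1 1) := by
    simp only [hG, Finset.mul_sum, ← Finset.sum_add_distrib]
    refine Finset.sum_congr rfl fun s _ => ?_
    simp only [mmseGain, Matrix.of_apply, Fin.sum_univ_two]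
    split_ifs <;> ring
  have j0 := congrFun (congrFun hJ 0) ν
  have j1 := congrFun (congrFun hJ 1) ν
  have eJ : ∀ μ κ, information N a t μ κ = (if μ = κ then 1 else 0) + G μ κ / N := fun _ _ => rfl
  simp only [Matrix.mul_apply, Fin.sum_univ_two, eJ, Matrix.one_apply] at j0 j1
  rw [hq]
  simp only [hc, Fin.sum_univ_two, hGs] at *
  fin_cases ν
  · simp only [Fin.zero_eta, Fin.isValue, if_true, one_ne_zero, zero_ne_one, if_false] at *
    have k0 : a 0 t + -(a 0 t / N) * (w 0 0 * G 0 0 + w 1 0 * G 0 1) = a 0 t * w 0 0 := by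
      linear_combination -(a 0 t) * j0
    have k1 : 0 + -(a 0 t / N) * (w 0 0 * G 0 1 + w 1 0 * G 1 1) = a 0 t * w 1 0 := by
      linear_combination -(a 0 t) * j1
    rw [k0, k1]
    have : N * ((a 0 t / N) ^ 2 * (w 0 0 ^ 2 * G 0 0 + 2 * (w 0 0 * w 1 0 * G 0 1) +
        w 1 0 ^ 2 * G 1 1)) = a 0 t ^ 2 * (w 0 0 ^ 2 * (G 0 0 / N) + 2 * (w 0 0 * w 1 0 *
        (G 0 1 / N)) + w 1 0 ^ 2 * (G 1 1 / N)) := by field_simp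
    rw [this]
    linear_combination a 0 t ^ 2 * (w 0 0 * j0 + w 1 0 * j1)
  · simp only [Fin.mk_one, Fin.isValue, if_true, one_ne_zero, zero_ne_one, if_false] at *
    have k0 : 0 + -(a 1 t / N) * (w 0 1 * G 0 0 + w 1 1 * G 0 1) = a 1 t * w 0 1 := by
      linear_combination -(a 1 t) * j0
    have k1 : a 1 t + -(a 1 t / N) * (w 0 1 * G 0 1 + w 1 1 * G 1 1) = a 1 t * w 1 1 := by
      linear_combination -(a 1 t) * j1
    rw [k0, k1]
    have : N * ((a 1 t / N) ^ 2 * (w 0 1 ^ 2 * G 0 0 + 2 * (w 0 1 * w 1 1 * G 0 1) +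
        w 1 1 ^ 2 * G 1 1)) = a 1 t ^ 2 * (w 0 1 ^ 2 * (G 0 0 / N) + 2 * (w 0 1 * w 1 1 *
        (G 0 1 / N)) + w 1 1 ^ 2 * (G 1 1 / N)) := by field_simp
    rw [this]
    linear_combination a 1 t ^ 2 * (w 0 1 * j0 + w 1 1 * j1)

end Linear

/-! ### Ozarow's scheme as a linear feedback scheme -/

/-- Ozarow's amplitudes in the first `m + 1` slots of a block of length `η`, zero afterwards. -/
def blockAmplitude (N ρ : ℝ) (P : Fin 2 → ℝ) (m η : ℕ) (ν : Fin 2) (t : Fin η) : ℝ :=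
  if (t : ℕ) ≤ m then amplitude N ρ (P ν) (![1, -1] ν) t else 0

theorem sum_lt_blockAmplitude_mul (N ρ : ℝ) (P : Fin 2 → ℝ) (m η : ℕ) (μ κ : Fin 2) {T : ℕ}
    (hT : T ≤ η) :
    (∑ s : Fin η, if (s : ℕ) < T then
      blockAmplitude N ρ P m η μ s * blockAmplitude N ρ P m η κ s else 0) =
    ∑ i ∈ Finset.range (min T (m + 1)),
      amplitude N ρ (P μ) (![1, -1] μ) i * amplitude N ρ (P κ) (![1, -1] κ) i := by
  simp only [blockAmplitude]
  rw [Fin.sum_univ_eq_sum_range (fun i => if i < T then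
    (if i ≤ m then amplitude N ρ (P μ) (![1, -1] μ) i else 0) *
    (if i ≤ m then amplitude N ρ (P κ) (![1, -1] κ) i else 0) else 0) η]
  have hsub : Finset.range (min T (m + 1)) ⊆ Finset.range η := by
    intro i hi
    simp only [Finset.mem_range, lt_min_iff] at hi ⊢
    omega
  symm
  rw [← Finset.sum_subset hsub]
  · refine Finset.sum_congr rfl fun i hi => ?_
    simp only [Finset.mem_range, lt_min_iff] at hi
    rw [if_pos hi.1, if_pos (by omega), if_pos (by omega)]
  · intro i _ hi
    simp only [Finset.mem_range, lt_min_iff, not_and_or, not_lt] at hi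
    split_ifs with h1 h2
    · omega
    · simp
    · rfl

section

variable {N ρ : ℝ} {P : Fin 2 → ℝ}

theorem sum_range_amplitude_cross_sq (hP : ∀ ν, 0 < P ν) (hN : 0 < N) (hρ : 0 < ρ) (hρ1 : ρ < 1)
    (h : RhoEquation (P 0) (P 1) N ρ) (t : ℕ) :
    ((∑ i ∈ Finset.range (t + 1), amplitude N ρ (P 0) 1 i * amplitude N ρ (P 1) (-1) i) / N) ^ 2 =
      ρ ^ 2 * ((1 + P 0 * (1 - ρ ^ 2) / N) ^ t / (1 - ρ) *
        ((1 + P 1 * (1 - ρ ^ 2) / N) ^ t / (1 - ρ))) := by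
  have hτ : 0 < 1 - ρ ^ 2 := by nlinarith
  have h0 := hP 0
  have h1 := hP 1
  rw [sum_amplitude_mul h0 h1 hN hρ hρ1 h, div_pow, mul_pow, mul_pow, pow_right_comm (-1 : ℝ),
    pow_right_comm (√_), Real.sq_sqrt (by positivity), mul_pow]
  rw [neg_one_sq, one_pow, one_mul, div_mul_div_comm, ← sq, mul_div_assoc]

/-- After the first slot det J = (1-ρ²)J₀₀J₁₁, hence (J⁻¹)_νν = 1/((1-ρ²)J_νν). The amplitudes are
scaled so that this factor leaves exactly P_ν. -/
theorem information_blockAmplitude (hP : ∀ ν, 0 < P ν) (hN : 0 < N) (hρ : 0 < ρ) (hρ1 : ρ < 1)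
    (h : RhoEquation (P 0) (P 1) N ρ) (m η : ℕ) (t : Fin η) :
    0 < (information N (blockAmplitude N ρ P m η) t).det ∧
    ∀ ν, blockAmplitude N ρ P m η ν t ^ 2 *
      (information N (blockAmplitude N ρ P m η) t)⁻¹ ν ν =
        if (t : ℕ) = 0 then N * ρ / (1 - ρ) else if (t : ℕ) ≤ m then P ν else 0 := by
  have hτ : 0 < 1 - ρ ^ 2 := by nlinarith
  have hr : 0 < 1 - ρ := by linarith
  have eJ : ∀ μ κ, information N (blockAmplitude N ρ P m η) t μ κ = (if μ = κ then 1 else 0) +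
      (∑ i ∈ Finset.range (min t (m + 1)),
        amplitude N ρ (P μ) (![1, -1] μ) i * amplitude N ρ (P κ) (![1, -1] κ) i) / N := by
    intro μ κ
    rw [← sum_lt_blockAmplitude_mul N ρ P m η μ κ t.isLt.le]
    rfl
  set J := information N (blockAmplitude N ρ P m η) t
  have hsign : ∀ ν : Fin 2, (![1, -1] ν : ℝ) ^ 2 = 1 := fun ν => by fin_cases ν <;> simp
  rcases Nat.eq_zero_or_pos t with ht | ht
  · have hJ : J = 1 := by
      ext μ κ
      rw [eJ, ht]
      simp [Matrix.one_apply]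
    rw [hJ]
    refine ⟨by simp, fun ν => ?_⟩
    simp only [inv_one, Matrix.one_apply_eq, mul_one, ht, if_true, blockAmplitude, zero_le]
    exact amplitude_zero_sq hN hρ hρ1
  -- Of the slots before t only those up to m are active, so the Gram sums have `j + 1` terms and
  -- stop growing in the idle slots.
  · obtain ⟨j, hj⟩ : ∃ j, min (t : ℕ) (m + 1) = j + 1 := ⟨min (t : ℕ) (m + 1) - 1, by omega⟩
    rw [hj] at eJ
    have h0 := hP 0
    have h1 := hP 1
    set L := fun ν => (1 + P ν * (1 - ρ ^ 2) / N) ^ j / (1 - ρ) with hL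
    have hLp : ∀ ν, 0 < L ν := fun ν => by have := hP ν; simp only [hL]; positivity
    have d : ∀ ν, J ν ν = L ν := fun ν => by
      rw [eJ, if_pos rfl, one_add_sum_amplitude_sq hN hρ hρ1 (hP ν) (hsign ν)]
    have hs : J 1 0 = J 0 1 := by
      rw [eJ, eJ]
      simp [mul_comm]
    have hc : J 0 1 ^ 2 = ρ ^ 2 * (L 0 * L 1) := by
      rw [eJ]
      simpa using sum_range_amplitude_cross_sq hP hN hρ hρ1 h j
    have hdet : J.det = (1 - ρ ^ 2) * (L 0 * L 1) := by
      rw [Matrix.det_fin_two, hs, d, d]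
      linear_combination -hc
    have hdp : 0 < J.det := by rw [hdet]; have := hLp 0; have := hLp 1; positivity
    refine ⟨hdp, fun ν => ?_⟩
    rw [if_neg ht.ne']
    by_cases htm : (t : ℕ) ≤ m
    · have htj : (t : ℕ) = j + 1 := by omega
      rw [if_pos htm, blockAmplitude, if_pos htm, htj,
        amplitude_succ_sq hN hρ hρ1 (hP ν) (hsign ν)]
      have hinv : J⁻¹ ν ν = 1 / ((1 - ρ ^ 2) * L ν) := by
        rw [Matrix.inv_def, Matrix.smul_apply, Matrix.adjugate_fin_two, hdet, Ring.inverse_eq_inv']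
        have := (hLp 0).ne'
        have := (hLp 1).ne'
        fin_cases ν
        · simp [d]; field_simp
        · simp [d]; field_simp
      rw [hinv]
      have := hP ν
      have hne : (1 + P ν * (1 - ρ ^ 2) / N) ^ j ≠ 0 := by positivity
      simp only [hL]
      generalize (1 + P ν * (1 - ρ ^ 2) / N) ^ j = x at *
      field_simp
    · rw [if_neg htm, blockAmplitude, if_neg htm]
      simp

/-- Ozarow's scheme: with `k` idle slots the powers are strictly below the allowed ones, and the
Gram matrix of the amplitudes grows at the rates of the dominant corner point. -/
theorem exists_linearScheme (hP : ∀ ν, 0 < P ν) (hN : 0 < N) (hρ : 0 < ρ) (hρ1 : ρ < 1)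
    (h : RhoEquation (P 0) (P 1) N ρ) : ∃ k : ℕ, ∀ m : ℕ,
    ∃ (a : Fin 2 → Fin (m + 1 + k) → ℝ)
      (F : Fin 2 → Matrix (Fin (m + 1 + k)) (Fin (m + 1 + k)) ℝ),
      (∀ ν i j, i ≤ j → F ν i j = 0) ∧
      (∀ ν, linearPower N a F ν < ((m + 1 + k : ℕ) : ℝ) * P ν) ∧
      (∀ ν, 1 + (∑ s, a ν s * a ν s) / N = (1 + P ν * (1 - ρ ^ 2) / N) ^ m / (1 - ρ)) ∧
      ((∑ s, a 0 s * a 1 s) / N) ^ 2 = ρ ^ 2 * ((1 + P 0 * (1 - ρ ^ 2) / N) ^ m / (1 - ρ) *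
        ((1 + P 1 * (1 - ρ ^ 2) / N) ^ m / (1 - ρ))) := by
  -- The first slot costs Nρ/(1-ρ), which may exceed P_ν; `k` idle slots pay for it. As `k` does not
  -- depend on `m`, it costs no rate in the limit.
  obtain ⟨k, hk⟩ : ∃ k : ℕ, ∀ ν, N * ρ / (1 - ρ) / P ν < k := by
    obtain ⟨k₀, hk₀⟩ := exists_nat_gt (N * ρ / (1 - ρ) / P 0)
    obtain ⟨k₁, hk₁⟩ := exists_nat_gt (N * ρ / (1 - ρ) / P 1)
    refine ⟨k₀ + k₁, Fin.forall_fin_two.2 ⟨?_, ?_⟩⟩ <;> push_cast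
    · linarith [(k₁.cast_nonneg : (0 : ℝ) ≤ k₁)]
    · linarith [(k₀.cast_nonneg : (0 : ℝ) ≤ k₀)]
  have hsum : ∀ m μ κ, (∑ s, blockAmplitude N ρ P m (m + 1 + k) μ s *
      blockAmplitude N ρ P m (m + 1 + k) κ s) = ∑ i ∈ Finset.range (m + 1),
        amplitude N ρ (P μ) (![1, -1] μ) i * amplitude N ρ (P κ) (![1, -1] κ) i := by
    intro m μ κ
    have := sum_lt_blockAmplitude_mul N ρ P m (m + 1 + k) μ κ le_rfl
    rw [min_eq_right (by omega)] at this
    rw [← this]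
    exact Finset.sum_congr rfl fun s _ => (if_pos s.isLt).symm
  have hsign : ∀ ν : Fin 2, (![1, -1] ν : ℝ) ^ 2 = 1 := fun ν => by fin_cases ν <;> simp
  refine ⟨k, fun m => ⟨blockAmplitude N ρ P m (m + 1 + k),
    mmseGain N (blockAmplitude N ρ P m (m + 1 + k)), mmseGain_strictLower _ _, fun ν => ?_,
    fun ν => ?_, ?_⟩⟩
  · have hi := information_blockAmplitude hP hN hρ hρ1 h m (m + 1 + k)
    rw [linearPower_mmseGain hN _ fun t => (hi t).1.ne', Finset.sum_congr rfl fun t _ => (hi t).2 ν,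
      Fin.sum_univ_eq_sum_range (fun t => if t = 0 then N * ρ / (1 - ρ) else
        if t ≤ m then P ν else 0) (m + 1 + k), Finset.sum_range_add, Finset.sum_range_succ']
    have e1 : ∑ t ∈ Finset.range m, (if t + 1 = 0 then N * ρ / (1 - ρ) else
        if t + 1 ≤ m then P ν else 0) = m * P ν := by
      rw [Finset.sum_congr rfl (g := fun _ => P ν)]
      · simp
      · intro t ht
        have := Finset.mem_range.1 ht
        rw [if_neg (by omega), if_pos (by omega)]
    have e2 : ∑ t ∈ Finset.range k, (if m + 1 + t = 0 then N * ρ / (1 - ρ) else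
        if m + 1 + t ≤ m then P ν else 0) = 0 :=
      Finset.sum_eq_zero fun t _ => by rw [if_neg (by omega), if_neg (by omega)]
    rw [e1, e2, if_pos rfl]
    have := (div_lt_iff₀ (hP ν)).1 (hk ν)
    push_cast
    linarith [hP ν]
  · rw [hsum, one_add_sum_amplitude_sq hN hρ hρ1 (hP ν) (hsign ν)]
  · rw [hsum]
    simpa using sum_range_amplitude_cross_sq hP hN hρ hρ1 h m

end

open Filter Topology

/-! ### Rates of the concatenated scheme without feedback noise -/

section Rates

variable {η : ℕ}

theorem noiseCov_zero (N : ℝ) (B : Fin 2 → Matrix (Fin η) (Fin η) ℝ) :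
    noiseCov N 0 B = N • (1 : Matrix (Fin η) (Fin η) ℝ) := by
  simp [noiseCov]

theorem gram_apply (a : Fin 2 → Fin η → ℝ) (μ κ : Fin 2) :
    ((aRow a).transpose * (aRow a).transpose.transpose) μ κ = ∑ s, a μ s * a κ s := by
  simp [Matrix.mul_apply, aRow]

theorem det_gram (a : Fin 2 → Fin η → ℝ) :
    ((aRow a).transpose * (aRow a).transpose.transpose).det =
      (∑ s, a 0 s * a 0 s) * (∑ s, a 1 s * a 1 s) - (∑ s, a 0 s * a 1 s) ^ 2 := by
  rw [Matrix.det_fin_two]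
  simp only [gram_apply, mul_comm (a 1 _) (a 0 _)]
  ring

/-- With G = CCᵀ the Gram matrix, C a_ν is column ν of G. The quotient is det(NG + G e_ν e_νᵀ
G)/det(NG) = 1 + G_νν/N. -/
theorem logDetRate_single {N : ℝ} (hN : 0 < N) (a : Fin 2 → Fin η → ℝ)
    (B : Fin 2 → Matrix (Fin η) (Fin η) ℝ)
    (hG : ((aRow a).transpose * (aRow a).transpose.transpose).det ≠ 0) (ν : Fin 2) :
    logDetRate (aRow a).transpose (Matrix.vecMulVec (a ν) (a ν)) (noiseCov N 0 B) =
      1 / (2 * (η : ℝ)) * Real.log (1 + (∑ s, a ν s * a ν s) / N) := by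
  rw [logDetRate, noiseCov_zero]
  congr 2
  set C := (aRow a).transpose with hC
  have hv : ∀ μ, (C.mulVec (a ν)) μ = ∑ s, a μ s * a ν s := fun μ => rfl
  have e1 : C * (Matrix.vecMulVec (a ν) (a ν) + N • (1 : Matrix (Fin η) (Fin η) ℝ)) * C.transpose =
      Matrix.vecMulVec (C.mulVec (a ν)) (C.mulVec (a ν)) + N • (C * C.transpose) := by
    rw [Matrix.mul_add, Matrix.add_mul, Matrix.mul_vecMulVec, Matrix.vecMulVec_mul,
      Matrix.vecMul_transpose]
    simp
  have e2 : C * (N • (1 : Matrix (Fin η) (Fin η) ℝ)) * C.transpose = N • (C * C.transpose) := by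
    simp
  rw [e1, e2, Matrix.det_smul, Fintype.card_fin,
    div_eq_iff (mul_ne_zero (pow_ne_zero _ hN.ne') hG), hC, det_gram, Matrix.det_fin_two]
  simp only [← hC, Matrix.add_apply, Matrix.smul_apply, Matrix.vecMulVec_apply, hv, smul_eq_mul]
  simp only [hC, gram_apply]
  simp only [mul_comm (a 1 _) (a 0 _)]
  field_simp
  fin_cases ν <;> simp only [Fin.zero_eta, Fin.mk_one, mul_comm (a 1 _) (a 0 _)] <;> ring_nf

/-- The numerator factors as det(G(G+N)), so the quotient is det(I + G/N). -/
theorem logDetRate_sum {N : ℝ} (hN : 0 < N) (a : Fin 2 → Fin η → ℝ)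
    (B : Fin 2 → Matrix (Fin η) (Fin η) ℝ)
    (hG : ((aRow a).transpose * (aRow a).transpose.transpose).det ≠ 0) :
    logDetRate (aRow a).transpose (aRow a * (aRow a).transpose) (noiseCov N 0 B) =
      1 / (2 * (η : ℝ)) * Real.log ((1 + (∑ s, a 0 s * a 0 s) / N) *
        (1 + (∑ s, a 1 s * a 1 s) / N) - ((∑ s, a 0 s * a 1 s) / N) ^ 2) := by
  rw [logDetRate, noiseCov_zero]
  congr 2
  set C := (aRow a).transpose with hC
  have e1 : C * (aRow a * C + N • (1 : Matrix (Fin η) (Fin η) ℝ)) * C.transpose =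
      (C * C.transpose) * (C * C.transpose + N • 1) := by
    have : aRow a = C.transpose := by simp [hC]
    rw [this]
    simp only [Matrix.mul_add, Matrix.add_mul, Matrix.mul_assoc, Matrix.mul_smul, Matrix.smul_mul,
      Matrix.mul_one]
  have e2 : C * (N • (1 : Matrix (Fin η) (Fin η) ℝ)) * C.transpose = N • (C * C.transpose) := by
    simp
  rw [e1, e2, Matrix.det_smul, Fintype.card_fin, Matrix.det_mul,
    div_eq_iff (mul_ne_zero (pow_ne_zero _ hN.ne') hG), mul_comm, ← mul_assoc]
  congr 1
  rw [Matrix.det_fin_two]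
  simp only [Matrix.add_apply, Matrix.smul_apply, Matrix.one_apply, smul_eq_mul, hC, gram_apply]
  simp only [mul_comm (a 1 _) (a 0 _)]
  simp
  field_simp
  ring

/-! ### Continuity in the feedback-noise covariance -/

theorem continuous_noiseCov (N : ℝ) (B : Fin 2 → Matrix (Fin η) (Fin η) ℝ) :
    Continuous fun K => noiseCov N K B := by
  unfold noiseCov
  have hk : Continuous fun K : Matrix (Fin 2) (Fin 2) ℝ =>
      K ⊗ₖ (1 : Matrix (Fin η) (Fin η) ℝ) := by
    refine continuous_matrix fun i j => ?_
    simp only [Matrix.kroneckerMap_apply]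
    fun_prop
  fun_prop

theorem continuous_inputPower (N : ℝ) (a : Fin 2 → Fin η → ℝ)
    (B : Fin 2 → Matrix (Fin η) (Fin η) ℝ) (ν : Fin 2) :
    Continuous fun K => inputPower N K a B ν := by
  unfold inputPower inputCov
  have hk : Continuous fun K : Matrix (Fin 2) (Fin 2) ℝ =>
      K ⊗ₖ (1 : Matrix (Fin η) (Fin η) ℝ) := by
    refine continuous_matrix fun i j => ?_
    simp only [Matrix.kroneckerMap_apply]
    fun_prop
  refine Continuous.matrix_trace (Continuous.matrix_submatrix ?_ _ _)
  fun_prop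

theorem continuousAt_logDetRate {N : ℝ} (C : Matrix (Fin 2) (Fin η) ℝ)
    (S : Matrix (Fin η) (Fin η) ℝ) (B : Fin 2 → Matrix (Fin η) (Fin η) ℝ)
    (h1 : (C * (S + noiseCov N 0 B) * C.transpose).det ≠ 0)
    (h2 : (C * noiseCov N 0 B * C.transpose).det ≠ 0) :
    ContinuousAt (fun K => logDetRate C S (noiseCov N K B)) 0 := by
  unfold logDetRate
  have hc := continuous_noiseCov N B
  refine continuousAt_const.mul (ContinuousAt.log ?_ (div_ne_zero h1 h2))
  refine ContinuousAt.div ?_ ?_ h2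
  · exact (Continuous.matrix_det (by fun_prop)).continuousAt
  · exact (Continuous.matrix_det (by fun_prop)).continuousAt

end Rates

/-- Covariance matrices of small trace are close to zero. -/
theorem exists_trace_bound_of_mem_nhds {U : Set (Matrix (Fin 2) (Fin 2) ℝ)} (hU : U ∈ 𝓝 0) :
    ∃ σ > (0 : ℝ), ∀ K : Matrix (Fin 2) (Fin 2) ℝ, K.PosSemidef → K.trace ≤ σ ^ 2 → K ∈ U := by
  obtain ⟨ε, hε, hb⟩ := Metric.mem_nhds_iff.1
    (show (U : Set (Fin 2 → Fin 2 → ℝ)) ∈ 𝓝 (0 : Fin 2 → Fin 2 → ℝ) from hU)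
  refine ⟨√(ε / 2), by positivity, fun K hK ht => hb ?_⟩
  rw [Real.sq_sqrt (by positivity)] at ht
  have h0 : 0 ≤ K 0 0 := hK.diag_nonneg
  have h1 : 0 ≤ K 1 1 := hK.diag_nonneg
  have hd := hK.det_nonneg
  have hs : K 1 0 = K 0 1 := by simpa using hK.1.apply 0 1
  rw [Matrix.det_fin_two, hs] at hd
  rw [Matrix.trace_fin_two] at ht
  -- The nonnegative determinant bounds K₀₁² by K₀₀K₁₁, so the trace alone controls the correlation.
  have hab : |K 0 1| ≤ ε / 2 := abs_le_of_sq_le_sq (by nlinarith) (by positivity)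
  refine mem_ball_zero_iff.2 ((pi_norm_lt_iff hε).2 fun i => (pi_norm_lt_iff hε).2 fun j => ?_)
  rw [Real.norm_eq_abs]
  have e0 : |K 0 0| < ε := by rw [abs_of_nonneg h0]; linarith
  have e1 : |K 1 1| < ε := by rw [abs_of_nonneg h1]; linarith
  have e2 : |K 0 1| < ε := by linarith
  fin_cases i <;> fin_cases j
  · exact e0
  · exact e2
  · simpa [hs] using e2
  · exact e1

/-! ### Achievability of the rectangle under small feedback noise. -/

theorem tendsto_affine_div (k : ℕ) (l c : ℝ) :
    Tendsto (fun m : ℕ => 1 / (2 * ((m + 1 + k : ℕ) : ℝ)) * (m * l + c)) atTop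
      (𝓝 (1 / 2 * l)) := by
  have hz : Tendsto (fun m : ℕ => (1 : ℝ) / ((m + 1 + k : ℕ) : ℝ)) atTop (𝓝 0) := by
    have := (tendsto_one_div_atTop_nhds_zero_nat (𝕜 := ℝ)).comp (tendsto_add_atTop_nat (1 + k))
    exact this.congr fun m => by simp [add_assoc]
  have := (hz.mul_const ((c - (1 + k) * l) / 2)).const_add (1 / 2 * l)
  rw [zero_mul, add_zero] at this
  refine this.congr fun m => ?_
  have hm : ((m : ℝ) + 1 + k) ≠ 0 := by positivity
  push_cast
  field_simp
  ring

/-- The right side is (1-ρ²)J₀J₁ - J₀ - J₁ + 1, and the threshold makes each linear term at most a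
quarter of the main one. For the scheme it is the determinant of Gram/N². The bound makes CCᵀ
nonsingular and later controls the zero-forcing noise. -/
theorem gram_det_lower {J₀ J₁ ρ : ℝ} (hτ : 0 < 1 - ρ ^ 2) (h₀ : 4 / (1 - ρ ^ 2) ≤ J₀)
    (h₁ : 4 / (1 - ρ ^ 2) ≤ J₁) :
    (1 - ρ ^ 2) / 2 * (J₀ * J₁) ≤ (J₀ - 1) * (J₁ - 1) - ρ ^ 2 * (J₀ * J₁) := by
  have p0 : 0 < J₀ := lt_of_lt_of_le (by positivity) h₀
  have p1 : 0 < J₁ := lt_of_lt_of_le (by positivity) h₁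
  rw [div_le_iff₀ hτ] at h₀ h₁
  nlinarith

theorem tendsto_pow_div_atTop {lam ρ : ℝ} (hl : 1 < lam) (hρ1 : ρ < 1) :
    Tendsto (fun m : ℕ => lam ^ m / (1 - ρ)) atTop atTop :=
  (tendsto_pow_atTop_atTop_of_one_lt hl).atTop_div_const (by linarith)

/-- Every pair strictly below the dominant corner is achieved for all small feedback noises. -/
theorem mem_rateRegion_of_lt {N ρ : ℝ} {P : Fin 2 → ℝ} (hP : ∀ ν, 0 < P ν) (hN : 0 < N)
    (hρ : 0 < ρ) (hρ1 : ρ < 1) (h : RhoEquation (P 0) (P 1) N ρ) {r : Fin 2 → ℝ}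
    (hr0 : ∀ ν, 0 ≤ r ν) (hr : ∀ ν, r ν < 1 / 2 * Real.log (1 + P ν * (1 - ρ ^ 2) / N)) :
    ∃ σ > (0 : ℝ), ∀ K : Matrix (Fin 2) (Fin 2) ℝ, K.PosSemidef → K.trace ≤ σ ^ 2 →
      (r 0, r 1) ∈ rateRegion (P 0) (P 1) N K := by
  have hτ : 0 < 1 - ρ ^ 2 := by nlinarith
  have hr1 : 0 < 1 - ρ := by linarith
  obtain ⟨k, hk⟩ := exists_linearScheme hP hN hρ hρ1 h
  set lam : Fin 2 → ℝ := fun ν => 1 + P ν * (1 - ρ ^ 2) / N with hlam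
  have hl1 : ∀ ν, 1 < lam ν := fun ν => by
    have := hP ν
    have : 0 < P ν * (1 - ρ ^ 2) / N := by positivity
    simp only [hlam]; linarith
  have hlp : ∀ ν, 0 < lam ν := fun ν => zero_lt_one.trans (hl1 ν)
  have ev1 : ∀ ν, ∀ᶠ m : ℕ in atTop,
      r ν < 1 / (2 * ((m + 1 + k : ℕ) : ℝ)) * Real.log (lam ν ^ m / (1 - ρ)) := fun ν => by
    filter_upwards [(tendsto_affine_div k (Real.log (lam ν)) (-Real.log (1 - ρ))).eventually
      (lt_mem_nhds (hr ν))] with m hm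
    rwa [Real.log_div (pow_ne_zero _ (hlp ν).ne') hr1.ne', Real.log_pow, sub_eq_add_neg]
  have ev2 : ∀ᶠ m : ℕ in atTop, r 0 + r 1 < 1 / (2 * ((m + 1 + k : ℕ) : ℝ)) *
      Real.log ((1 - ρ ^ 2) * (lam 0 ^ m / (1 - ρ) * (lam 1 ^ m / (1 - ρ)))) := by
    have hlt : r 0 + r 1 < 1 / 2 * (Real.log (lam 0) + Real.log (lam 1)) := by
      have := hr 0
      have := hr 1
      simp only [hlam]
      linarith
    filter_upwards [(tendsto_affine_div k (Real.log (lam 0) + Real.log (lam 1))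
      (Real.log (1 - ρ ^ 2) - 2 * Real.log (1 - ρ))).eventually (lt_mem_nhds hlt)] with m hm
    have q0 := (hlp 0).ne'
    have q1 := (hlp 1).ne'
    rw [Real.log_mul hτ.ne' (by positivity), Real.log_mul (by positivity) (by positivity),
      Real.log_div (pow_ne_zero _ q0) hr1.ne', Real.log_div (pow_ne_zero _ q1) hr1.ne',
      Real.log_pow, Real.log_pow]
    refine hm.trans_eq ?_
    ring
  have ev3 : ∀ ν, ∀ᶠ m : ℕ in atTop, 4 / (1 - ρ ^ 2) ≤ lam ν ^ m / (1 - ρ) := fun ν =>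
    (tendsto_pow_div_atTop (hl1 ν) hρ1).eventually_ge_atTop _
  -- The block is fixed here, before any K appears; only the powers and rates will depend on K.
  obtain ⟨m, hm0, hm1, hm2, hm3, hm4⟩ :=
    ((ev1 0).and ((ev1 1).and (ev2.and ((ev3 0).and (ev3 1))))).exists
  obtain ⟨a, F, hF, hpow, hJ, hX⟩ := hk m
  set B := feedbackMatrix F
  have hdet : 0 < ((aRow a).transpose * (aRow a).transpose.transpose).det := by
    have := gram_det_lower hτ hm3 hm4
    have hpos : 0 < (1 - ρ ^ 2) / 2 * (lam 0 ^ m / (1 - ρ) * (lam 1 ^ m / (1 - ρ))) := by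
      have := hlp 0
      have := hlp 1
      positivity
    rw [← hX] at this
    simp only [hlam] at this hpos
    rw [← hJ 0, ← hJ 1] at this hpos
    have h3 := hpos.trans_le this
    rw [det_gram]
    have e : (1 + (∑ s, a 0 s * a 0 s) / N - 1) * (1 + (∑ s, a 1 s * a 1 s) / N - 1) -
        ((∑ s, a 0 s * a 1 s) / N) ^ 2 = ((∑ s, a 0 s * a 0 s) * (∑ s, a 1 s * a 1 s) -
          (∑ s, a 0 s * a 1 s) ^ 2) / N ^ 2 := by
      field_simp
      ring
    rw [e] at h3
    exact (div_pos_iff_of_pos_right (by positivity)).1 h3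
  have hl : ∀ ν, logDetRate (aRow a).transpose (Matrix.vecMulVec (a ν) (a ν)) (noiseCov N 0 B) =
      1 / (2 * ((m + 1 + k : ℕ) : ℝ)) * Real.log (lam ν ^ m / (1 - ρ)) := fun ν => by
    rw [logDetRate_single hN a B hdet.ne', hJ ν]
  have hls : logDetRate (aRow a).transpose (aRow a * (aRow a).transpose) (noiseCov N 0 B) =
      1 / (2 * ((m + 1 + k : ℕ) : ℝ)) *
        Real.log ((1 - ρ ^ 2) * (lam 0 ^ m / (1 - ρ) * (lam 1 ^ m / (1 - ρ)))) := by
    rw [logDetRate_sum hN a B hdet.ne', hJ 0, hJ 1, hX]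
    congr 2
    simp only [hlam]
    ring
  -- A vanishing determinant would make the quotient 0, hence its logarithm 0 by convention. A
  -- positive rate therefore certifies that both determinants are nonzero, as continuity requires.
  have hnz : ∀ S : Matrix (Fin (m + 1 + k)) (Fin (m + 1 + k)) ℝ,
      0 < logDetRate (aRow a).transpose S (noiseCov N 0 B) →
      ((aRow a).transpose * (S + noiseCov N 0 B) * (aRow a).transpose.transpose).det ≠ 0 ∧
      ((aRow a).transpose * noiseCov N 0 B * (aRow a).transpose.transpose).det ≠ 0 := by
    intro S hS
    constructor <;> intro h0 <;> rw [logDetRate, h0] at hS <;> simp at hS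
  have c1 : ∀ ν, ∀ᶠ K in 𝓝 (0 : Matrix (Fin 2) (Fin 2) ℝ),
      r ν < logDetRate (aRow a).transpose (Matrix.vecMulVec (a ν) (a ν)) (noiseCov N K B) := by
    intro ν
    have hlt : r ν < logDetRate (aRow a).transpose (Matrix.vecMulVec (a ν) (a ν))
        (noiseCov N 0 B) := by
      rw [hl]
      fin_cases ν
      · exact hm0
      · exact hm1
    obtain ⟨n1, n2⟩ := hnz _ ((hr0 ν).trans_lt hlt)
    exact (continuousAt_logDetRate _ _ B n1 n2).eventually (lt_mem_nhds hlt)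
  have c2 : ∀ᶠ K in 𝓝 (0 : Matrix (Fin 2) (Fin 2) ℝ),
      r 0 + r 1 < logDetRate (aRow a).transpose (aRow a * (aRow a).transpose)
        (noiseCov N K B) := by
    have hlt : r 0 + r 1 < logDetRate (aRow a).transpose (aRow a * (aRow a).transpose)
        (noiseCov N 0 B) := by
      rw [hls]
      exact hm2
    obtain ⟨n1, n2⟩ := hnz _ ((add_nonneg (hr0 0) (hr0 1)).trans_lt hlt)
    exact (continuousAt_logDetRate _ _ B n1 n2).eventually (lt_mem_nhds hlt)
  have c3 : ∀ ν, ∀ᶠ K in 𝓝 (0 : Matrix (Fin 2) (Fin 2) ℝ),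
      inputPower N K a B ν < ((m + 1 + k : ℕ) : ℝ) * P ν := fun ν =>
    (continuous_inputPower N a B ν).continuousAt.eventually
      (gt_mem_nhds ((inputPower_feedbackMatrix N a hF ν).trans_lt (hpow ν)))
  obtain ⟨σ, hσ, hK⟩ := exists_trace_bound_of_mem_nhds
    (((c1 0).and (c1 1)).and (c2.and ((c3 0).and (c3 1))))
  refine ⟨σ, hσ, fun K hKp hKt => subset_closure ?_⟩
  obtain ⟨⟨k0, k1⟩, k2, k3, k4⟩ := hK K hKp hKt
  exact ⟨m + 1 + k, a, B, (aRow a).transpose, by omega,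
    fun ν i j hij => feedbackMatrix_strictLower hF ν hij, k3.le, k4.le,
    Or.inl ⟨isUnit_iff_ne_zero.2 hdet.ne', hr0 0, hr0 1, k0.le, k1.le, k2.le⟩⟩

theorem ozarowRegion_subset_closure {P₁ P₂ N : ℝ} (hP₁ : 0 < P₁) (hP₂ : 0 < P₂) (hN : 0 < N) :
    ozarowRegion P₁ P₂ N (rhoStar P₁ P₂ N) ⊆ closure (vanishingNoiseRegion P₁ P₂ N) := by
  obtain ⟨hI, he⟩ := rhoStar_spec hP₁ hP₂ hN
  obtain ⟨hρ, hρ1⟩ := rhoEquation_pos_lt_one hP₁ hP₂ hN hI he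
  set ρ := rhoStar P₁ P₂ N
  have hτ : 0 < 1 - ρ ^ 2 := by nlinarith
  rintro ⟨R₁, R₂⟩ ⟨h1, h2, h3, h4, -⟩
  simp only at h1 h2 h3 h4
  have hpos : ∀ p : ℝ, 0 < p → 0 < 1 / 2 * Real.log (1 + p * (1 - ρ ^ 2) / N) := fun p hp => by
    have : 0 < p * (1 - ρ ^ 2) / N := by positivity
    have := Real.log_pos (show 1 < 1 + p * (1 - ρ ^ 2) / N by linarith)
    linarith
  -- Scaling by c < 1 puts both coordinates strictly below the corner, whose coordinates are
  -- positive since ρ* < 1.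
  have hlim : Tendsto (fun c : ℝ => (c * R₁, c * R₂)) (𝓝[<] 1) (𝓝 (R₁, R₂)) := by
    have : ContinuousAt (fun c : ℝ => (c * R₁, c * R₂)) 1 := by fun_prop
    have := this.tendsto
    simp only [one_mul] at this
    exact this.mono_left nhdsWithin_le_nhds
  refine mem_closure_of_tendsto hlim ?_
  filter_upwards [Ioo_mem_nhdsLT (zero_lt_one (α := ℝ))] with c hc
  have hlt : ∀ x y : ℝ, 0 ≤ x → x ≤ y → 0 < y → c * x < y := fun x y hx hxy hy => by
    nlinarith [hc.1, hc.2]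
  obtain ⟨σ, hσ, hK⟩ := mem_rateRegion_of_lt (P := ![P₁, P₂]) (r := ![c * R₁, c * R₂])
    (Fin.forall_fin_two.2 ⟨hP₁, hP₂⟩) hN hρ hρ1 he
    (Fin.forall_fin_two.2 ⟨mul_nonneg hc.1.le h1, mul_nonneg hc.1.le h2⟩)
    (Fin.forall_fin_two.2 ⟨hlt _ _ h1 h3 (hpos _ hP₁), hlt _ _ h2 h4 (hpos _ hP₂)⟩)
  exact Set.mem_iUnion₂.2 ⟨σ, hσ, Set.mem_iInter₂.2 fun K hKm => hK K hKm.1 hKm.2⟩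

/-- Divided by N², the quartic says that the product of the two individual log arguments is the
sum-rate argument; at ρ* the region is therefore a full rectangle. -/
theorem ozarowCorner_mem_ozarowRegion {P₁ P₂ N : ℝ} (hP₁ : 0 < P₁) (hP₂ : 0 < P₂) (hN : 0 < N) :
    ozarowCorner P₁ P₂ N ∈ ozarowRegion P₁ P₂ N (rhoStar P₁ P₂ N) ∧
    (ozarowCorner P₁ P₂ N).1 + (ozarowCorner P₁ P₂ N).2 = 1 / 2 * Real.log
      (1 + (P₁ + P₂ + 2 * √(P₁ * P₂) * rhoStar P₁ P₂ N) / N) := by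
  obtain ⟨hI, he⟩ := rhoStar_spec hP₁ hP₂ hN
  obtain ⟨hρ, hρ1⟩ := rhoEquation_pos_lt_one hP₁ hP₂ hN hI he
  unfold ozarowCorner
  set ρ := rhoStar P₁ P₂ N
  have hτ : 0 < 1 - ρ ^ 2 := by nlinarith
  have hpos : ∀ p : ℝ, 0 < p → 0 ≤ 1 / 2 * Real.log (1 + p * (1 - ρ ^ 2) / N) := fun p hp => by
    have : 0 < p * (1 - ρ ^ 2) / N := by positivity
    have := Real.log_nonneg (show 1 ≤ 1 + p * (1 - ρ ^ 2) / N by linarith)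
    linarith
  have hsum : 1 / 2 * Real.log (1 + P₁ * (1 - ρ ^ 2) / N) +
      1 / 2 * Real.log (1 + P₂ * (1 - ρ ^ 2) / N) =
      1 / 2 * Real.log (1 + (P₁ + P₂ + 2 * √(P₁ * P₂) * ρ) / N) := by
    rw [← mul_add, ← Real.log_mul (by positivity) (by positivity)]
    congr 2
    unfold RhoEquation at he
    field_simp
    linarith
  exact ⟨⟨hpos _ hP₁, hpos _ hP₂, le_rfl, le_rfl, hsum.le⟩, hsum⟩

/-- The regions of the concatenated scheme approach the dominant corner point. -/
theorem exists_mem_rateRegion_near_corner {P₁ P₂ N : ℝ} (hP₁ : 0 < P₁) (hP₂ : 0 < P₂)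
    (hN : 0 < N) {ε : ℝ} (hε : 0 < ε) : ∃ σ > (0 : ℝ), ∀ K : Matrix (Fin 2) (Fin 2) ℝ,
      K.PosSemidef → K.trace ≤ σ ^ 2 →
        ∃ R ∈ rateRegion P₁ P₂ N K, dist R (ozarowCorner P₁ P₂ N) < ε := by
  obtain ⟨R, hR, hd⟩ := Metric.mem_closure_iff.1 (ozarowRegion_subset_closure hP₁ hP₂ hN
    (ozarowCorner_mem_ozarowRegion hP₁ hP₂ hN).1) ε hε
  obtain ⟨σ, hσ, hK⟩ := Set.mem_iUnion₂.1 hR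
  exact ⟨σ, hσ, fun K hp ht => ⟨R, Set.mem_iInter₂.1 hK K ⟨hp, ht⟩, by rwa [dist_comm]⟩⟩

open MeasureTheory ProbabilityTheory Filter Topology
open scoped ENNReal

/-! ### Causal shears of Lebesgue measure -/

section Shear

variable {n : ℕ}

/-- The first `t` coordinates of `y`. -/
def past (y : Fin n → ℝ) (t : Fin n) : Fin t → ℝ := fun i => y (Fin.castLE t.isLt.le i)

/-- Subtracts from each coordinate a function of the previous ones. -/
def shear (h : (t : Fin n) → (Fin t → ℝ) → ℝ) (y : Fin n → ℝ) (t : Fin n) : ℝ :=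
  y t - h t (past y t)

theorem measurable_past (t : Fin n) : Measurable fun y : Fin n → ℝ => past y t :=
  measurable_pi_lambda _ fun _ => measurable_pi_apply _

theorem measurable_shear {h : (t : Fin n) → (Fin t → ℝ) → ℝ} (hh : ∀ t, Measurable (h t)) :
    Measurable (shear h) :=
  measurable_pi_lambda _ fun t => (measurable_pi_apply t).sub ((hh t).comp (measurable_past t))

/-- The map is triangular with translations in each fibre: splitting off the last coordinate gives a
skew product over the shear of the others. No smoothness of `h` is needed, which matters because the
encoders are only measurable. -/
theorem measurePreserving_shear : ∀ {n : ℕ} {h : (t : Fin n) → (Fin t → ℝ) → ℝ},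
    (∀ t, Measurable (h t)) → MeasurePreserving (shear h) volume volume
  | 0, h, _ => by
    have : shear h = id := by
      ext y t
      exact t.elim0
    rw [this]
    exact MeasurePreserving.id _
  | n + 1, h, hh => by
    let h' : (t : Fin n) → (Fin t → ℝ) → ℝ := fun t => h t.castSucc
    have ih : MeasurePreserving (shear h') volume volume :=
      measurePreserving_shear fun t => hh t.castSucc
    let e := MeasurableEquiv.piFinSuccAbove (fun _ : Fin (n + 1) => ℝ) (Fin.last n)
    have he : MeasurePreserving e volume volume :=
      volume_preserving_piFinSuccAbove (fun _ => ℝ) (Fin.last n)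
    have hl : Measurable fun x : Fin n → ℝ => h (Fin.last n) x := hh (Fin.last n)
    have hs : MeasurePreserving (fun p : (Fin n → ℝ) × ℝ =>
        (shear h' p.1, p.2 - h (Fin.last n) p.1)) (volume.prod volume) (volume.prod volume) := by
      refine ih.skew_product (g := fun x b => b - h (Fin.last n) x) ?_ ?_
      · exact measurable_snd.sub (hl.comp measurable_fst)
      · exact Filter.Eventually.of_forall fun x => (measurePreserving_sub_right volume _).map_eq
    have hsw := Measure.measurePreserving_swap (μ := (volume : Measure ℝ))
      (ν := (volume : Measure (Fin n → ℝ)))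
    have hsw' := Measure.measurePreserving_swap (μ := (volume : Measure (Fin n → ℝ)))
      (ν := (volume : Measure ℝ))
    have key := (he.symm e).comp (hsw'.comp (hs.comp (hsw.comp he)))
    have hfun : shear h = e.symm ∘ Prod.swap ∘ (fun p : (Fin n → ℝ) × ℝ =>
        (shear h' p.1, p.2 - h (Fin.last n) p.1)) ∘ Prod.swap ∘ e := by
      funext y
      rw [Function.comp_apply, MeasurableEquiv.eq_symm_apply]
      refine Prod.ext ?_ (funext fun i => ?_)
      · simp only [e, MeasurableEquiv.piFinSuccAbove_apply, Fin.insertNthEquiv_symm_apply,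
          Function.comp_apply, Prod.swap_prod_mk, shear]
        congr 2
        funext j
        simp only [past, Fin.removeNth_apply, Fin.succAbove_last]
        rfl
      · have hi : (e (shear h y)).2 i = shear h y i.castSucc := by
          rw [← Fin.succAbove_last_apply i]
          rfl
        have hy : (e y).2 = fun i => y i.castSucc := by
          funext i
          rw [← Fin.succAbove_last_apply i]
          rfl
        rw [hi]
        simp only [Function.comp_apply, Prod.snd_swap, Prod.fst_swap, hy]
        rfl
    rw [hfun]
    exact key

end Shear

/-! ### Gaussian densities -/

theorem lintegral_fin_prod : ∀ {n : ℕ} {g : Fin n → ℝ → ℝ≥0∞}, (∀ i, Measurable (g i)) →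
    ∫⁻ z : Fin n → ℝ, ∏ i, g i (z i) = ∏ i, ∫⁻ x, g i x
  | 0, g, _ => by simp [volume_pi, Measure.pi_empty_univ]
  | n + 1, g, hg => by
    rw [Fin.prod_univ_succ, ← lintegral_fin_prod fun i => hg i.succ,
      ← lintegral_prod_mul (hg 0).aemeasurable
        (Finset.measurable_fun_prod _ fun i _ =>
          (hg i.succ).comp (measurable_pi_apply i)).aemeasurable, ← Measure.volume_eq_prod,
      ← (volume_preserving_piFinSuccAbove (fun _ : Fin (n + 1) => ℝ) 0).lintegral_comp_emb
        (MeasurableEquiv.measurableEmbedding _)]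
    refine lintegral_congr fun z => ?_
    rw [Fin.prod_univ_succ]
    rfl

/-- The density of `n` i.i.d. centred Gaussians of variance `v`. -/
def iidDensity {n : ℕ} (v : ℝ) (z : Fin n → ℝ) : ℝ≥0∞ := ∏ i, gaussianPDF 0 v.toNNReal (z i)

theorem measurable_iidDensity {n : ℕ} (v : ℝ) : Measurable (iidDensity (n := n) v) :=
  Finset.measurable_fun_prod _ fun i _ =>
    (measurable_gaussianPDF 0 v.toNNReal).comp (measurable_pi_apply i)

instance noiseLaw_isProbabilityMeasure (n : ℕ) (N : ℝ) : IsProbabilityMeasure (noiseLaw n N) := by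
  unfold noiseLaw
  infer_instance

theorem noiseLaw_eq_withDensity {n : ℕ} {N : ℝ} (hN : 0 < N) :
    noiseLaw n N = volume.withDensity (iidDensity N) := by
  have hv : N.toNNReal ≠ 0 := by simpa using hN
  refine Measure.pi_eq fun s hs => ?_
  rw [withDensity_apply _ (MeasurableSet.univ_pi hs), ← lintegral_indicator
    (MeasurableSet.univ_pi hs)]
  have : ∀ z : Fin n → ℝ, (Set.univ.pi s).indicator (iidDensity N) z =
      ∏ i, (s i).indicator (gaussianPDF 0 N.toNNReal) (z i) := by
    intro z
    by_cases hz : z ∈ Set.univ.pi s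
    · rw [Set.indicator_of_mem hz]
      exact Finset.prod_congr rfl fun i _ => (Set.indicator_of_mem (hz i (Set.mem_univ i)) _).symm
    · rw [Set.indicator_of_notMem hz]
      obtain ⟨i, hi⟩ : ∃ i, z i ∉ s i := by simpa [Set.mem_pi] using hz
      exact (Finset.prod_eq_zero (Finset.mem_univ i) (Set.indicator_of_notMem hi _)).symm
  rw [lintegral_congr this, lintegral_fin_prod
    fun i => (measurable_gaussianPDF 0 N.toNNReal).indicator (hs i)]
  refine Finset.prod_congr rfl fun i _ => ?_
  rw [lintegral_indicator (hs i), gaussianReal_apply _ hv]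

theorem lintegral_iidDensity {n : ℕ} {v : ℝ} (hv : 0 < v) :
    ∫⁻ z : Fin n → ℝ, iidDensity v z = 1 := by
  have := measure_univ (μ := noiseLaw n v)
  rwa [noiseLaw_eq_withDensity hv, withDensity_apply _ MeasurableSet.univ,
    Measure.restrict_univ] at this

theorem gaussianPDF_mul_exp {N s : ℝ} (hN : 0 < N) (hs : 0 < s) (z u : ℝ) :
    gaussianPDF 0 N.toNNReal z * ENNReal.ofReal
      (Real.exp (-(1 / 2 * Real.log (s / N) + u ^ 2 / (2 * s) - z ^ 2 / (2 * N)))) =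
      gaussianPDF 0 s.toNNReal u := by
  simp only [gaussianPDF_def, gaussianPDFReal_def, Real.coe_toNNReal _ hN.le,
    Real.coe_toNNReal _ hs.le, sub_zero]
  rw [← ENNReal.ofReal_mul (by positivity)]
  congr 1
  have e : Real.exp (-(1 / 2 * Real.log (s / N) + u ^ 2 / (2 * s) - z ^ 2 / (2 * N))) =
      (√(s / N))⁻¹ * (Real.exp (-u ^ 2 / (2 * s)) * Real.exp (z ^ 2 / (2 * N))) := by
    rw [Real.sqrt_eq_rpow, Real.rpow_def_of_pos (by positivity), ← Real.exp_neg, ← Real.exp_add,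
      ← Real.exp_add]
    congr 1
    ring
  rw [e, Real.sqrt_div hs.le, Real.sqrt_mul (show 0 ≤ 2 * Real.pi by positivity) N,
    Real.sqrt_mul (show 0 ≤ 2 * Real.pi by positivity) s]
  have e2 : Real.exp (-z ^ 2 / (2 * N)) * Real.exp (z ^ 2 / (2 * N)) = 1 := by
    rw [← Real.exp_add]
    simp [neg_div]
  have : 0 < √N := Real.sqrt_pos.2 hN
  have : 0 < √s := Real.sqrt_pos.2 hs
  have hpi : 0 < √(2 * Real.pi) := by positivity
  generalize √(2 * Real.pi) = c at *
  have e3 : (c * √N)⁻¹ * (√s / √N)⁻¹ = (c * √s)⁻¹ := by field_simp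
  calc _ = ((c * √N)⁻¹ * (√s / √N)⁻¹) * Real.exp (-u ^ 2 / (2 * s)) *
        (Real.exp (-z ^ 2 / (2 * N)) * Real.exp (z ^ 2 / (2 * N))) := by ring
    _ = _ := by rw [e2, e3, mul_one]

/-! ### Change of measure -/

section ChangeOfMeasure

variable {n : ℕ}

/-- The logarithm of the ratio of the channel law of noise variance `N` to the auxiliary causal
Gaussian law of variance `s`, when the noise is `z` and the innovation of the auxiliary law
is `u`. -/
def logRatio (N s : ℝ) (u z : Fin n → ℝ) : ℝ :=
  ∑ t, (1 / 2 * Real.log (s / N) + u t ^ 2 / (2 * s) - z t ^ 2 / (2 * N))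

/-- The auxiliary output law: a causal Gaussian law with conditional means `h` and variance `s`. -/
def auxLaw (s : ℝ) (h : (t : Fin n) → (Fin t → ℝ) → ℝ) : Measure (Fin n → ℝ) :=
  volume.withDensity fun y => iidDensity s (shear h y)

theorem isProbabilityMeasure_auxLaw {s : ℝ} (hs : 0 < s) {h : (t : Fin n) → (Fin t → ℝ) → ℝ}
    (hh : ∀ t, Measurable (h t)) : IsProbabilityMeasure (auxLaw s h) := by
  constructor
  rw [auxLaw, withDensity_apply _ MeasurableSet.univ, Measure.restrict_univ,
    (measurePreserving_shear hh).lintegral_comp (measurable_iidDensity s), lintegral_iidDensity hs]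

/-- `T` turns the noise into the outputs of the channel with inputs `x`, and the exponential factor
is the likelihood ratio of the auxiliary law to the channel law. Substituting z = `shear x y`
preserves Lebesgue measure and leaves the auxiliary density. -/
theorem lintegral_exp_neg_logRatio {N s : ℝ} (hN : 0 < N) (hs : 0 < s)
    {h x : (t : Fin n) → (Fin t → ℝ) → ℝ} (hh : ∀ t, Measurable (h t))
    (hx : ∀ t, Measurable (x t)) {T : (Fin n → ℝ) → Fin n → ℝ} (hTm : Measurable T)
    (hT : ∀ y, T (shear x y) = y) {g : (Fin n → ℝ) → ℝ≥0∞} (hg : Measurable g) :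
    ∫⁻ z, ENNReal.ofReal (Real.exp (-logRatio N s (shear h (T z)) z)) * g (T z) ∂noiseLaw n N =
      ∫⁻ y, g y ∂auxLaw s h := by
  have hsm := measurable_shear hh
  have hm : Measurable fun z : Fin n → ℝ =>
      ENNReal.ofReal (Real.exp (-logRatio N s (shear h (T z)) z)) * g (T z) := by
    refine Measurable.mul ?_ (hg.comp hTm)
    refine ENNReal.measurable_ofReal.comp (Real.measurable_exp.comp (Measurable.neg ?_))
    refine Finset.measurable_fun_sum _ fun t _ => ?_
    have h1 : Measurable fun z => shear h (T z) t := (measurable_pi_apply t).comp (hsm.comp hTm)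
    have h2 : Measurable fun z : Fin n → ℝ => z t := measurable_pi_apply t
    fun_prop
  have hden : ∀ z u : Fin n → ℝ, iidDensity N z *
      ENNReal.ofReal (Real.exp (-logRatio N s u z)) = iidDensity s u := by
    intro z u
    rw [logRatio, ← Finset.sum_neg_distrib, Real.exp_sum,
      ENNReal.ofReal_prod_of_nonneg fun _ _ => (Real.exp_pos _).le, iidDensity,
      ← Finset.prod_mul_distrib]
    exact Finset.prod_congr rfl fun t _ => gaussianPDF_mul_exp hN hs _ _
  rw [noiseLaw_eq_withDensity hN, lintegral_withDensity_eq_lintegral_mul _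
    (measurable_iidDensity N) hm, auxLaw, lintegral_withDensity_eq_lintegral_mul _
    (show Measurable fun y => iidDensity s (shear h y) from (measurable_iidDensity s).comp hsm) hg]
  have e : ∀ z : Fin n → ℝ, (iidDensity N * fun z : Fin n → ℝ =>
      ENNReal.ofReal (Real.exp (-logRatio N s (shear h (T z)) z)) * g (T z) :
        (Fin n → ℝ) → ℝ≥0∞) z = iidDensity s (shear h (T z)) * g (T z) := by
    intro z
    rw [Pi.mul_apply, ← mul_assoc, hden]
  rw [lintegral_congr e, ← (measurePreserving_shear hx).lintegral_comp
    (show Measurable fun z => iidDensity s (shear h (T z)) * g (T z) from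
      ((measurable_iidDensity s).comp (hsm.comp hTm)).mul (hg.comp hTm))]
  simp only [hT]
  rfl

/-- A Fano-type inequality for one message: the probability of a decoding set is controlled by the
log-likelihood ratio to an auxiliary law. -/
theorem log_mul_prob_le {N s L : ℝ} (hN : 0 < N) (hs : 0 < s) (hL : 1 ≤ L)
    {h x : (t : Fin n) → (Fin t → ℝ) → ℝ} (hh : ∀ t, Measurable (h t))
    (hx : ∀ t, Measurable (x t)) {T : (Fin n → ℝ) → Fin n → ℝ} (hTm : Measurable T)
    (hT : ∀ y, T (shear x y) = y) {E : Set (Fin n → ℝ)} (hE : MeasurableSet E)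
    (hint : Integrable (fun z => logRatio N s (shear h (T z)) z) (noiseLaw n N)) :
    Real.log L * (noiseLaw n N).real (T ⁻¹' E) ≤
      ∫ z, logRatio N s (shear h (T z)) z ∂noiseLaw n N + Real.log 2 +
        (1 / 2 * (1 + L * (auxLaw s h).real E) - 1) := by
  classical
  have := isProbabilityMeasure_auxLaw hs hh
  set ℓ := fun z => logRatio N s (shear h (T z)) z
  set f : (Fin n → ℝ) → ℝ := E.indicator fun _ => Real.log L with hf
  have hL0 : 0 < L := by linarith
  have hfm : Measurable f := measurable_const.indicator hE
  have hfi : Integrable (fun z => f (T z)) (noiseLaw n N) := by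
    have : (fun z => f (T z)) = (T ⁻¹' E).indicator fun _ => Real.log L := rfl
    rw [this]
    exact (integrable_const _).indicator (hTm hE)
  have hlin : ∫⁻ z, ENNReal.ofReal (Real.exp (f (T z) - ℓ z)) ∂noiseLaw n N ≤
      ENNReal.ofReal (1 + L * (auxLaw s h).real E) := by
    have e : ∀ z, ENNReal.ofReal (Real.exp (f (T z) - ℓ z)) =
        ENNReal.ofReal (Real.exp (-ℓ z)) * ENNReal.ofReal (Real.exp (f (T z))) := by
      intro z
      rw [← ENNReal.ofReal_mul (Real.exp_pos _).le, ← Real.exp_add]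
      congr 2
      ring
    rw [lintegral_congr e, lintegral_exp_neg_logRatio hN hs hh hx hTm hT
      (g := fun y => ENNReal.ofReal (Real.exp (f y))) (by fun_prop)]
    calc ∫⁻ y, ENNReal.ofReal (Real.exp (f y)) ∂auxLaw s h
        ≤ ∫⁻ y, (1 + E.indicator (fun _ => ENNReal.ofReal L) y) ∂auxLaw s h := by
          refine lintegral_mono fun y => ?_
          by_cases hy : y ∈ E
          · simp [hf, hy, Real.exp_log hL0]
          · simp [hf, hy]
      _ = 1 + ENNReal.ofReal L * auxLaw s h E := by
          rw [lintegral_add_left measurable_const, lintegral_indicator hE]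
          simp
      _ = _ := by
          rw [ENNReal.ofReal_add zero_le_one (by positivity), ENNReal.ofReal_mul hL0.le,
            ENNReal.ofReal_one, ofReal_measureReal]
  have hmeas : AEStronglyMeasurable (fun z => Real.exp (f (T z) - ℓ z)) (noiseLaw n N) :=
    Real.continuous_exp.comp_aestronglyMeasurable
      (hfi.aestronglyMeasurable.sub hint.aestronglyMeasurable)
  have hexp : Integrable (fun z => Real.exp (f (T z) - ℓ z)) (noiseLaw n N) := by
    refine ⟨hmeas, ?_⟩
    rw [hasFiniteIntegral_iff_ofReal (Eventually.of_forall fun z => (Real.exp_pos _).le)]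
    exact hlin.trans_lt ENNReal.ofReal_lt_top
  have hexpI : ∫ z, Real.exp (f (T z) - ℓ z) ∂noiseLaw n N ≤ 1 + L * (auxLaw s h).real E := by
    rw [integral_eq_lintegral_of_nonneg_ae (Eventually.of_forall fun z => (Real.exp_pos _).le)
      hmeas]
    exact ENNReal.toReal_le_of_le_ofReal (by positivity) hlin
  -- The tangent to the logarithm at 2 replaces Jensen's inequality. This tangent point is chosen so
  -- that, over L disjoint decoding sets, the terms (1 + L·Q(E))/2 - 1 add up to at most 0.
  have hpt : ∀ z, f (T z) - ℓ z ≤ Real.log 2 + (1 / 2 * Real.exp (f (T z) - ℓ z) - 1) := by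
    intro z
    have := Real.log_le_sub_one_of_pos (x := 1 / 2 * Real.exp (f (T z) - ℓ z)) (by positivity)
    rw [Real.log_mul (by norm_num) (Real.exp_pos _).ne', Real.log_exp, one_div, Real.log_inv] at this
    linarith
  have hexp2 : Integrable (fun z => 1 / 2 * Real.exp (f (T z) - ℓ z)) (noiseLaw n N) :=
    hexp.const_mul _
  have hexp3 : Integrable (fun z => 1 / 2 * Real.exp (f (T z) - ℓ z) - 1) (noiseLaw n N) :=
    hexp2.sub (integrable_const _)
  have hI := integral_mono (hfi.sub hint) (g := fun z => Real.log 2 +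
    (1 / 2 * Real.exp (f (T z) - ℓ z) - 1))
    ((integrable_const _).add hexp3) hpt
  have e1 : ∫ z, ((fun z => f (T z)) - ℓ) z ∂noiseLaw n N =
      Real.log L * (noiseLaw n N).real (T ⁻¹' E) - ∫ z, ℓ z ∂noiseLaw n N := by
    have e0 : ∫ z, f (T z) ∂noiseLaw n N = Real.log L * (noiseLaw n N).real (T ⁻¹' E) := by
      have : (fun z => f (T z)) = (T ⁻¹' E).indicator fun _ => Real.log L := rfl
      rw [this, integral_indicator (hTm hE)]
      simp [mul_comm]
    rw [← e0]
    exact integral_sub hfi hint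
  have e2 : ∫ z, (Real.log 2 + (1 / 2 * Real.exp (f (T z) - ℓ z) - 1)) ∂noiseLaw n N =
      Real.log 2 + (1 / 2 * ∫ z, Real.exp (f (T z) - ℓ z) ∂noiseLaw n N - 1) := by
    rw [integral_add (integrable_const _) hexp3, integral_sub hexp2 (integrable_const _),
      integral_const_mul]
    simp
  rw [e1, e2] at hI
  linarith

/-- The Fano-type inequality for a family of messages with disjoint decoding sets. -/
theorem log_card_mul_sum_prob_le {ι : Type*} [Fintype ι] [Nonempty ι] {N s : ℝ} (hN : 0 < N)
    (hs : 0 < s) {h : (t : Fin n) → (Fin t → ℝ) → ℝ} (hh : ∀ t, Measurable (h t))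
    {x : ι → (t : Fin n) → (Fin t → ℝ) → ℝ} (hx : ∀ i t, Measurable (x i t))
    {T : ι → (Fin n → ℝ) → Fin n → ℝ} (hTm : ∀ i, Measurable (T i))
    (hT : ∀ i y, T i (shear (x i) y) = y) {E : ι → Set (Fin n → ℝ)}
    (hE : ∀ i, MeasurableSet (E i)) (hd : Pairwise fun i j => Disjoint (E i) (E j))
    (hint : ∀ i, Integrable (fun z => logRatio N s (shear h (T i z)) z) (noiseLaw n N)) :
    Real.log (Fintype.card ι) * ∑ i, (noiseLaw n N).real (T i ⁻¹' E i) ≤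
      ∑ i, ∫ z, logRatio N s (shear h (T i z)) z ∂noiseLaw n N +
        Fintype.card ι * Real.log 2 := by
  have := isProbabilityMeasure_auxLaw hs hh
  have hc : (1 : ℝ) ≤ Fintype.card ι := by exact_mod_cast Fintype.card_pos
  have hsum : ∑ i, (auxLaw s h).real (E i) ≤ 1 := by
    rw [← measureReal_iUnion_fintype hd hE]
    exact measureReal_le_one
  have := Finset.sum_le_sum fun i (_ : i ∈ Finset.univ) =>
    log_mul_prob_le hN hs hc hh (hx i) (hTm i) (hT i) (hE i) (hint i)
  rw [← Finset.mul_sum] at this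
  refine this.trans ?_
  simp only [Finset.sum_add_distrib, Finset.sum_sub_distrib, Finset.sum_const, Finset.card_univ,
    nsmul_eq_mul, ← Finset.mul_sum]
  nlinarith

end ChangeOfMeasure

/-! ### Outputs and inputs of a feedback code -/

namespace FeedbackCode

variable {n : ℕ} (c : FeedbackCode n) (m₁ : Fin c.M₁) (m₂ : Fin c.M₂)

/-- The sum of the two channel inputs as a causal function of the outputs. -/
def totalInput (t : Fin n) (p : Fin t → ℝ) : ℝ := c.enc₁ t m₁ p + c.enc₂ t m₂ p

/-- The vector of all channel outputs. -/
def received (z : Fin n → ℝ) : Fin n → ℝ := c.output m₁ m₂ z n le_rfl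

theorem measurable_totalInput (t : Fin n) : Measurable (c.totalInput m₁ m₂ t) :=
  (c.measurable_enc₁ t m₁).add (c.measurable_enc₂ t m₂)

theorem output_castLE (z : Fin n → ℝ) {t : ℕ} : ∀ {s : ℕ} (hts : t ≤ s) (hs : s ≤ n) (i : Fin t),
    c.output m₁ m₂ z s hs (Fin.castLE hts i) = c.output m₁ m₂ z t (hts.trans hs) i
  | 0, hts, hs, i => (Nat.not_lt_zero _ (i.isLt.trans_le hts)).elim
  | s + 1, hts, hs, i => by
    rcases Nat.lt_or_ge s t with h | h
    · obtain rfl : t = s + 1 := by omega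
      rfl
    · rw [show Fin.castLE hts i = (Fin.castLE h i).castSucc from rfl, output, Fin.snoc_castSucc,
        output_castLE z h _ i]

theorem past_received (z : Fin n → ℝ) (t : Fin n) :
    past (c.received m₁ m₂ z) t = c.output m₁ m₂ z t t.isLt.le :=
  funext fun i => c.output_castLE m₁ m₂ z t.isLt.le le_rfl i

theorem received_apply (z : Fin n → ℝ) (t : Fin n) :
    c.received m₁ m₂ z t = c.totalInput m₁ m₂ t (c.output m₁ m₂ z t t.isLt.le) + z t := by
  have h := c.output_castLE m₁ m₂ z (t := t + 1) t.isLt le_rfl (Fin.last t)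
  rw [show Fin.castLE (Nat.succ_le_of_lt t.isLt) (Fin.last (t : ℕ)) = t from rfl] at h
  rw [received, h, output, Fin.snoc_last]
  rfl

theorem output_eq_of_forall (y z : Fin n → ℝ)
    (h : ∀ t, y t = c.totalInput m₁ m₂ t (past y t) + z t) :
    ∀ (t : ℕ) (ht : t ≤ n), c.output m₁ m₂ z t ht = fun i => y (Fin.castLE ht i)
  | 0, _ => funext fun i => i.elim0
  | t + 1, ht => by
    have ih := output_eq_of_forall y z h t (Nat.le_of_succ_le ht)
    funext i
    refine Fin.lastCases ?_ (fun j => ?_) i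
    · rw [output, Fin.snoc_last, ih]
      exact (h ⟨t, ht⟩).symm
    · rw [output, Fin.snoc_castSucc, ih]
      rfl

theorem received_eq_of_forall {y z : Fin n → ℝ}
    (h : ∀ t, y t = c.totalInput m₁ m₂ t (past y t) + z t) : c.received m₁ m₂ z = y :=
  c.output_eq_of_forall m₁ m₂ y z h n le_rfl

theorem received_shear (y : Fin n → ℝ) :
    c.received m₁ m₂ (shear (c.totalInput m₁ m₂) y) = y :=
  c.received_eq_of_forall m₁ m₂ fun t => by rw [shear]; ring

theorem measurable_output : ∀ (t : ℕ) (ht : t ≤ n), Measurable fun z => c.output m₁ m₂ z t ht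
  | 0, _ => measurable_pi_lambda _ fun i => i.elim0
  | t + 1, ht => by
    have ih := measurable_output t (Nat.le_of_succ_le ht)
    refine measurable_pi_lambda _ fun i => ?_
    refine Fin.lastCases ?_ (fun j => ?_) i
    · simp only [output, Fin.snoc_last]
      exact (((c.measurable_enc₁ _ m₁).comp ih).add ((c.measurable_enc₂ _ m₂).comp ih)).add
        (measurable_pi_apply _)
    · simp only [output, Fin.snoc_castSucc]
      exact (measurable_pi_apply j).comp ih

theorem measurable_received : Measurable (c.received m₁ m₂) := c.measurable_output m₁ m₂ n le_rfl

theorem output_congr {z z' : Fin n → ℝ} : ∀ (t : ℕ) (ht : t ≤ n),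
    (∀ i : Fin n, (i : ℕ) < t → z i = z' i) → c.output m₁ m₂ z t ht = c.output m₁ m₂ z' t ht
  | 0, _, _ => rfl
  | t + 1, ht, h => by
    rw [output, output, output_congr t _ fun i hi => h i (by omega), h ⟨t, ht⟩ (by simp)]

theorem measurable_input₁ (t : Fin n) : Measurable fun z => c.input₁ m₁ m₂ z t :=
  (c.measurable_enc₁ t m₁).comp (c.measurable_output m₁ m₂ t _)

theorem measurable_input₂ (t : Fin n) : Measurable fun z => c.input₂ m₁ m₂ z t :=
  (c.measurable_enc₂ t m₂).comp (c.measurable_output m₁ m₂ t _)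

/-- Causality in the form needed to make the inputs at time t orthogonal to the noise at time t. -/
theorem output_update (z : Fin n → ℝ) (t : Fin n) (x : ℝ) :
    c.output m₁ m₂ (Function.update z t x) t t.isLt.le = c.output m₁ m₂ z t t.isLt.le :=
  c.output_congr m₁ m₂ t _ fun i hi => Function.update_of_ne (fun h => by simp [h] at hi) _ _

end FeedbackCode

/-! ### Moments of the noise -/

section Noise

variable {n : ℕ}

/-- The sign symmetry of a single noise variable does the work of independence between past and
present. -/
theorem measurePreserving_flip (N : ℝ) (t : Fin n) :
    MeasurePreserving (fun z : Fin n → ℝ => Function.update z t (-z t))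
      (noiseLaw n N) (noiseLaw n N) := by
  have h := measurePreserving_pi (fun _ : Fin n => gaussianReal 0 N.toNNReal)
    (fun _ : Fin n => gaussianReal 0 N.toNNReal) (f := fun i x => if i = t then -x else x) (by
      intro i
      by_cases hi : i = t
      · simp only [hi, if_true]
        exact ⟨measurable_neg, by simpa using gaussianReal_map_neg (μ := 0) (v := N.toNNReal)⟩
      · simp only [hi, if_false]
        exact MeasurePreserving.id _)
  have hfun : (fun z : Fin n → ℝ => Function.update z t (-z t)) =
      fun z i => if i = t then -z i else z i := by
    funext z i
    by_cases hi : i = t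
    · subst hi
      simp
    · simp [hi]
  rw [hfun]
  exact h

theorem memLp_noise (N : ℝ) (t : Fin n) : MemLp (fun z : Fin n → ℝ => z t) 2 (noiseLaw n N) :=
  (memLp_id_gaussianReal' (μ := 0) (v := N.toNNReal) 2 (by simp)).comp_measurePreserving
    (measurePreserving_eval (fun _ : Fin n => gaussianReal 0 N.toNNReal) t)

theorem integral_noise_sq {N : ℝ} (hN : 0 < N) (t : Fin n) :
    ∫ z, z t ^ 2 ∂noiseLaw n N = N := by
  have h := variance_fun_id_gaussianReal (μ := 0) (v := N.toNNReal)
  rw [variance_eq_integral aemeasurable_id'] at h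
  simp only [integral_id_gaussianReal, sub_zero, Real.coe_toNNReal _ hN.le] at h
  refine Eq.trans ?_ h
  exact integral_comp_eval (μ := fun _ : Fin n => gaussianReal 0 N.toNNReal) (i := t)
    (f := fun x : ℝ => x ^ 2) (by fun_prop)

/-- A random variable that does not depend on the noise at time `t` is orthogonal to it. -/
theorem integral_mul_noise_eq_zero (N : ℝ) (t : Fin n) {D : (Fin n → ℝ) → ℝ} (hD : Measurable D)
    (hf : ∀ z, D (Function.update z t (-z t)) = D z) :
    ∫ z, D z * z t ∂noiseLaw n N = 0 := by
  have hm : Measurable fun z : Fin n → ℝ => D z * z t := hD.mul (measurable_pi_apply t)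
  have hmp := measurePreserving_flip (n := n) N t
  have h := integral_map (μ := noiseLaw n N) hmp.measurable.aemeasurable
    (f := fun z => D z * z t) hm.aestronglyMeasurable
  rw [hmp.map_eq] at h
  simp only [hf, Function.update_self, mul_neg, integral_neg] at h
  linarith

/-- By the flip symmetry `D t` is orthogonal to the noise at t, so the innovation has second moment
E[D²] + N, while the last term of each summand integrates to -1/2. -/
theorem integral_logRatio {N s : ℝ} (hN : 0 < N) {D : Fin n → (Fin n → ℝ) → ℝ}
    (hD : ∀ t, Measurable (D t)) (hD2 : ∀ t, Integrable (fun z => D t z ^ 2) (noiseLaw n N))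
    (hf : ∀ t z, D t (Function.update z t (-z t)) = D t z) :
    Integrable (fun z => logRatio N s (fun t => D t z + z t) z) (noiseLaw n N) ∧
    ∫ z, logRatio N s (fun t => D t z + z t) z ∂noiseLaw n N =
      n / 2 * Real.log (s / N) + (n * N + ∑ t, ∫ z, D t z ^ 2 ∂noiseLaw n N) / (2 * s) - n / 2 := by
  have hDL : ∀ t, MemLp (D t) 2 (noiseLaw n N) := fun t =>
    (memLp_two_iff_integrable_sq (hD t).aestronglyMeasurable).2 (hD2 t)
  have hz2 : ∀ t, Integrable (fun z : Fin n → ℝ => z t ^ 2) (noiseLaw n N) := fun t =>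
    (memLp_noise N t).integrable_sq
  have hDz : ∀ t, Integrable (fun z => D t z * z t) (noiseLaw n N) := fun t =>
    (hDL t).integrable_mul (memLp_noise N t)
  have hterm : ∀ t (z : Fin n → ℝ), 1 / 2 * Real.log (s / N) + (D t z + z t) ^ 2 / (2 * s) -
      z t ^ 2 / (2 * N) = 1 / 2 * Real.log (s / N) + (1 / (2 * s) * D t z ^ 2 +
      (1 / s * (D t z * z t) + (1 / (2 * s) - 1 / (2 * N)) * z t ^ 2)) := by
    intro t z
    rcases eq_or_ne s 0 with rfl | hs
    · simp
      ring
    · field_simp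
      ring
  have i1 : ∀ t, Integrable (fun z : Fin n → ℝ => 1 / s * (D t z * z t) +
      (1 / (2 * s) - 1 / (2 * N)) * z t ^ 2) (noiseLaw n N) := fun t =>
    ((hDz t).const_mul _).add ((hz2 t).const_mul _)
  have i2 : ∀ t, Integrable (fun z : Fin n → ℝ => 1 / (2 * s) * D t z ^ 2 +
      (1 / s * (D t z * z t) + (1 / (2 * s) - 1 / (2 * N)) * z t ^ 2)) (noiseLaw n N) := fun t =>
    ((hD2 t).const_mul _).add (i1 t)
  have i3 : ∀ t, Integrable (fun z : Fin n → ℝ => 1 / 2 * Real.log (s / N) +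
      (1 / (2 * s) * D t z ^ 2 + (1 / s * (D t z * z t) +
        (1 / (2 * s) - 1 / (2 * N)) * z t ^ 2))) (noiseLaw n N) := fun t =>
    (integrable_const _).add (i2 t)
  simp only [logRatio, hterm]
  refine ⟨integrable_finsetSum _ fun t _ => i3 t, ?_⟩
  rw [integral_finsetSum _ fun t _ => i3 t]
  have e : ∀ t, ∫ z : Fin n → ℝ, (1 / 2 * Real.log (s / N) + (1 / (2 * s) * D t z ^ 2 +
      (1 / s * (D t z * z t) + (1 / (2 * s) - 1 / (2 * N)) * z t ^ 2))) ∂noiseLaw n N =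
      1 / 2 * Real.log (s / N) + N / (2 * s) - 1 / 2 +
        1 / (2 * s) * ∫ z, D t z ^ 2 ∂noiseLaw n N := by
    intro t
    rw [integral_add (integrable_const _) (i2 t), integral_add ((hD2 t).const_mul _) (i1 t),
      integral_add ((hDz t).const_mul _) ((hz2 t).const_mul _),
      integral_const_mul (1 / (2 * s)), integral_const_mul (1 / s),
      integral_const_mul (1 / (2 * s) - 1 / (2 * N)), integral_noise_sq hN,
      integral_mul_noise_eq_zero N t (hD t) (hf t)]
    simp only [integral_const, probReal_univ, smul_eq_mul, one_mul, mul_zero, zero_add]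
    have : 1 / (2 * N) * N = 1 / 2 := by field_simp
    rw [sub_mul, this]
    ring
  simp only [e, Finset.sum_add_distrib, ← Finset.mul_sum, Finset.sum_const, Finset.card_univ,
    Fintype.card_fin, nsmul_eq_mul]
  ring

end Noise

/-! ### The converse for perfect feedback -/

namespace FeedbackCode

variable {n : ℕ} (c : FeedbackCode n)

/-- Conditional means of the auxiliary output law for which the innovation is
`α X₁ + β X₂ + Z`. -/
def center (α β : ℝ) (m : Fin c.M₁ × Fin c.M₂) (t : Fin n) (p : Fin t → ℝ) : ℝ :=
  (1 - α) * c.enc₁ t m.1 p + (1 - β) * c.enc₂ t m.2 p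

/-- One auxiliary law must serve the whole family, so its conditional means may not involve the
messages that vary: this is `hm`. It allows α = β = 1 for all pairs, α = 1 when only the first
message varies, and β = 1 when only the second does. -/
theorem fano {ι : Type*} [Fintype ι] [Nonempty ι] {N s : ℝ} (hN : 0 < N) (hs : 0 < s) (α β : ℝ)
    (h1 : ∀ m₁ m₂ t, Integrable (fun z => c.input₁ m₁ m₂ z t ^ 2) (noiseLaw n N))
    (h2 : ∀ m₁ m₂ t, Integrable (fun z => c.input₂ m₁ m₂ z t ^ 2) (noiseLaw n N))
    (m : ι → Fin c.M₁ × Fin c.M₂) (hm : ∀ i j, c.center α β (m i) = c.center α β (m j))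
    {E : ι → Set (Fin n → ℝ)} (hE : ∀ i, MeasurableSet (E i))
    (hd : Pairwise fun i j => Disjoint (E i) (E j)) :
    Real.log (Fintype.card ι) *
        ∑ i, (noiseLaw n N).real (c.received (m i).1 (m i).2 ⁻¹' E i) ≤
      ∑ i, (n / 2 * Real.log (s / N) + (n * N + ∑ t, ∫ z, (α * c.input₁ (m i).1 (m i).2 z t +
        β * c.input₂ (m i).1 (m i).2 z t) ^ 2 ∂noiseLaw n N) / (2 * s) - n / 2) +
        Fintype.card ι * Real.log 2 := by
  obtain ⟨i₀⟩ := ‹Nonempty ι›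
  have : Nonempty ι := ⟨i₀⟩
  set h := c.center α β (m i₀) with hh
  have hhm : ∀ t, Measurable (h t) := fun t =>
    ((c.measurable_enc₁ t (m i₀).1).const_mul (1 - α)).add
      ((c.measurable_enc₂ t (m i₀).2).const_mul (1 - β))
  let D : ι → Fin n → (Fin n → ℝ) → ℝ := fun i t z =>
    α * c.input₁ (m i).1 (m i).2 z t + β * c.input₂ (m i).1 (m i).2 z t
  have hDm : ∀ i t, Measurable (D i t) := fun i t =>
    ((c.measurable_input₁ (m i).1 (m i).2 t).const_mul α).add
      ((c.measurable_input₂ (m i).1 (m i).2 t).const_mul β)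
  have hDL : ∀ i t, MemLp (D i t) 2 (noiseLaw n N) := fun i t =>
    (((memLp_two_iff_integrable_sq (c.measurable_input₁ _ _ t).aestronglyMeasurable).2
      (h1 (m i).1 (m i).2 t)).const_mul α).add
    (((memLp_two_iff_integrable_sq (c.measurable_input₂ _ _ t).aestronglyMeasurable).2
      (h2 (m i).1 (m i).2 t)).const_mul β)
  have hsh : ∀ i z, shear h (c.received (m i).1 (m i).2 z) = fun t => D i t z + z t := by
    intro i z
    funext t
    rw [hh, hm i₀ i, shear, past_received, received_apply, center, totalInput]
    simp only [D, input₁, input₂]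
    ring
  have hI := fun i => integral_logRatio (s := s) hN (hDm i) (fun t => (hDL i t).integrable_sq)
    (fun t z => by simp only [D, input₁, input₂, output_update])
  have key := log_card_mul_sum_prob_le hN hs hhm
    (fun i => c.measurable_totalInput (m i).1 (m i).2)
    (fun i => c.measurable_received (m i).1 (m i).2)
    (fun i => c.received_shear (m i).1 (m i).2) hE hd
    (fun i => by simp only [hsh]; exact (hI i).1)
  refine key.trans_eq ?_
  congr 1
  refine Finset.sum_congr rfl fun i _ => ?_
  simp only [hsh]
  exact (hI i).2

theorem card_pos : 0 < c.M₁ ∧ 0 < c.M₂ :=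
  ⟨(c.dec 0).1.pos, (c.dec 0).2.pos⟩

theorem measurableSet_dec_preimage (S : Set (Fin c.M₁ × Fin c.M₂)) : MeasurableSet (c.dec ⁻¹' S) :=
  c.measurable_dec (Set.toFinite S).measurableSet

/-- The probability of correct decoding, summed over all messages. -/
theorem sum_prob_correct (N : ℝ) :
    ∑ m₁, ∑ m₂, (noiseLaw n N).real (c.received m₁ m₂ ⁻¹' (c.dec ⁻¹' {(m₁, m₂)})) =
      (c.M₁ : ℝ) * c.M₂ * (1 - c.errorProb N) := by
  obtain ⟨h1, h2⟩ := c.card_pos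
  have hW : ((c.M₁ : ℝ) * c.M₂) ≠ 0 := by positivity
  have e : ∀ m₁ m₂, (noiseLaw n N).real (c.received m₁ m₂ ⁻¹' (c.dec ⁻¹' {(m₁, m₂)})) =
      1 - (noiseLaw n N).real {z | c.dec (c.output m₁ m₂ z n le_rfl) ≠ (m₁, m₂)} := by
    intro m₁ m₂
    rw [← probReal_compl_eq_one_sub]
    · congr 1
      ext z
      simp [received]
    · exact (c.measurable_received m₁ m₂) (c.measurableSet_dec_preimage {p | p ≠ (m₁, m₂)})
  simp only [e, Finset.sum_sub_distrib, Finset.sum_const, Finset.card_univ, Fintype.card_fin,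
    nsmul_eq_mul, mul_one, errorProb]
  field_simp

/-- When the innovation variance, averaged over messages, is at most s, the quadratic term is on
average at most k/2 and only the logarithm remains. -/
theorem sum_logRatio_bound {M₁ M₂ : ℕ} {N s k l : ℝ} (hs : 0 < s) {J : Fin M₁ → Fin M₂ → ℝ}
    (hJ : ∑ m₁, ∑ m₂, J m₁ m₂ ≤ k * (M₁ * M₂) * (s - N)) :
    ∑ m₁, ∑ m₂, (k / 2 * l + (k * N + J m₁ m₂) / (2 * s) - k / 2) ≤
      M₁ * M₂ * (k / 2 * l) := by
  have e : ∑ m₁, ∑ m₂, (k / 2 * l + (k * N + J m₁ m₂) / (2 * s) - k / 2) =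
      M₁ * M₂ * (k / 2 * l + k * N / (2 * s) - k / 2) + (∑ m₁, ∑ m₂, J m₁ m₂) / (2 * s) := by
    simp only [add_div, Finset.sum_add_distrib, Finset.sum_sub_distrib, Finset.sum_const,
      Finset.card_univ, Fintype.card_fin, nsmul_eq_mul, Finset.sum_div]
    ring
  have h : (∑ m₁, ∑ m₂, J m₁ m₂) / (2 * s) ≤ k * (M₁ * M₂) * (s - N) / (2 * s) := by gcongr
  rw [e]
  have e2 : k * (M₁ * M₂) * (s - N) / (2 * s) =
      M₁ * M₂ * (k / 2) - M₁ * M₂ * (k * N / (2 * s)) := by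
    field_simp
  rw [e2] at h
  linarith

/-- The sum over messages and times of `E[(α X₁ + β X₂)²]`. -/
def energy (N α β : ℝ) : ℝ :=
  ∑ m₁, ∑ m₂, ∑ t, ∫ z, (α * c.input₁ m₁ m₂ z t + β * c.input₂ m₁ m₂ z t) ^ 2 ∂noiseLaw n N

/-- The sum over messages and times of `E[X₁ X₂]`. -/
def crossEnergy (N : ℝ) : ℝ :=
  ∑ m₁, ∑ m₂, ∑ t, ∫ z, c.input₁ m₁ m₂ z t * c.input₂ m₁ m₂ z t ∂noiseLaw n N

section

variable {N : ℝ}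

theorem energy_eq
    (h1 : ∀ m₁ m₂ t, Integrable (fun z => c.input₁ m₁ m₂ z t ^ 2) (noiseLaw n N))
    (h2 : ∀ m₁ m₂ t, Integrable (fun z => c.input₂ m₁ m₂ z t ^ 2) (noiseLaw n N))
    (α β : ℝ) : c.energy N α β =
    α ^ 2 * c.energy N 1 0 + 2 * α * β * c.crossEnergy N + β ^ 2 * c.energy N 0 1 := by
  simp only [energy, crossEnergy, Finset.mul_sum, ← Finset.sum_add_distrib, one_mul, zero_mul,
    add_zero, zero_add]
  refine Finset.sum_congr rfl fun m₁ _ => Finset.sum_congr rfl fun m₂ _ =>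
    Finset.sum_congr rfl fun t _ => ?_
  have i12 : Integrable (fun z => c.input₁ m₁ m₂ z t * c.input₂ m₁ m₂ z t) (noiseLaw n N) :=
    ((memLp_two_iff_integrable_sq (c.measurable_input₁ m₁ m₂ t).aestronglyMeasurable).2
      (h1 m₁ m₂ t)).integrable_mul
    ((memLp_two_iff_integrable_sq (c.measurable_input₂ m₁ m₂ t).aestronglyMeasurable).2
      (h2 m₁ m₂ t))
  have e : ∀ z, (α * c.input₁ m₁ m₂ z t + β * c.input₂ m₁ m₂ z t) ^ 2 =
      α ^ 2 * c.input₁ m₁ m₂ z t ^ 2 + 2 * α * β * (c.input₁ m₁ m₂ z t * c.input₂ m₁ m₂ z t) +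
        β ^ 2 * c.input₂ m₁ m₂ z t ^ 2 := fun z => by ring
  have i3 : Integrable (fun z => α ^ 2 * c.input₁ m₁ m₂ z t ^ 2 +
      2 * α * β * (c.input₁ m₁ m₂ z t * c.input₂ m₁ m₂ z t)) (noiseLaw n N) :=
    ((h1 m₁ m₂ t).const_mul _).add (i12.const_mul _)
  simp only [e]
  rw [integral_add i3 ((h2 m₁ m₂ t).const_mul _),
    integral_add ((h1 m₁ m₂ t).const_mul _) (i12.const_mul _), integral_const_mul,
    integral_const_mul, integral_const_mul]

theorem energy_nonneg (α β : ℝ) : 0 ≤ c.energy N α β :=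
  Finset.sum_nonneg fun _ _ => Finset.sum_nonneg fun _ _ => Finset.sum_nonneg fun _ _ =>
    integral_nonneg fun _ => sq_nonneg _

theorem sumRate_bound
    (h1 : ∀ m₁ m₂ t, Integrable (fun z => c.input₁ m₁ m₂ z t ^ 2) (noiseLaw n N))
    (h2 : ∀ m₁ m₂ t, Integrable (fun z => c.input₂ m₁ m₂ z t ^ 2) (noiseLaw n N))
    (hN : 0 < N) {s : ℝ} (hs : 0 < s)
    (hE : c.energy N 1 1 ≤ n * (c.M₁ * c.M₂) * (s - N)) :
    (1 - c.errorProb N) * (Real.log c.M₁ + Real.log c.M₂) ≤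
      n / 2 * Real.log (s / N) + Real.log 2 := by
  obtain ⟨p1, p2⟩ := c.card_pos
  have : Nonempty (Fin c.M₁ × Fin c.M₂) := ⟨c.dec 0⟩
  have h := c.fano hN hs 1 1 h1 h2 (fun m : Fin c.M₁ × Fin c.M₂ => m)
    (fun i j => by funext t p; simp [center]) (E := fun m => c.dec ⁻¹' {m})
    (fun m => c.measurableSet_dec_preimage _)
    (fun i j hij => (Set.disjoint_singleton.2 hij).preimage _)
  simp only [Fintype.sum_prod_type, Fintype.card_prod, Fintype.card_fin, sum_prob_correct,
    Nat.cast_mul] at h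
  have hb := sum_logRatio_bound (l := Real.log (s / N)) hs hE
  have hW : (0 : ℝ) < c.M₁ * c.M₂ := by positivity
  rw [Real.log_mul (by positivity) (by positivity)] at h
  refine le_of_mul_le_mul_left ?_ hW
  linarith

theorem rate₁_bound
    (h1 : ∀ m₁ m₂ t, Integrable (fun z => c.input₁ m₁ m₂ z t ^ 2) (noiseLaw n N))
    (h2 : ∀ m₁ m₂ t, Integrable (fun z => c.input₂ m₁ m₂ z t ^ 2) (noiseLaw n N))
    (hN : 0 < N) {s : ℝ} (hs : 0 < s) (β : ℝ)
    (hE : c.energy N 1 β ≤ n * (c.M₁ * c.M₂) * (s - N)) :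
    (1 - c.errorProb N) * Real.log c.M₁ ≤ n / 2 * Real.log (s / N) + Real.log 2 := by
  obtain ⟨p1, p2⟩ := c.card_pos
  have : Nonempty (Fin c.M₁) := ⟨(c.dec 0).1⟩
  have h := Finset.sum_le_sum fun m₂ (_ : m₂ ∈ Finset.univ) =>
    c.fano hN hs 1 β h1 h2 (fun m₁ : Fin c.M₁ => (m₁, m₂))
    (fun i j => by funext t p; simp [center]) (E := fun m₁ => c.dec ⁻¹' {p | p.1 = m₁})
    (fun m => c.measurableSet_dec_preimage _)
    (fun i j hij => Disjoint.preimage _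
      (Set.disjoint_left.2 fun p hp hq => hij (hp.symm.trans hq)))
  rw [← Finset.mul_sum, Finset.sum_comm, Finset.sum_add_distrib] at h
  nth_rw 2 [Finset.sum_comm] at h
  simp only [Fintype.card_fin, Finset.sum_const, Finset.card_univ, nsmul_eq_mul] at h
  have hb := sum_logRatio_bound (l := Real.log (s / N)) hs hE
  -- Decoding the pair correctly entails decoding the first message correctly.
  have hc : (c.M₁ : ℝ) * c.M₂ * (1 - c.errorProb N) ≤ ∑ m₁, ∑ m₂,
      (noiseLaw n N).real (c.received m₁ m₂ ⁻¹' (c.dec ⁻¹' {p | p.1 = m₁})) := by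
    rw [← sum_prob_correct]
    refine Finset.sum_le_sum fun m₁ _ => Finset.sum_le_sum fun m₂ _ => measureReal_mono ?_
    exact Set.preimage_mono (Set.preimage_mono fun p hp => by simp_all)
  have hW : (0 : ℝ) < c.M₁ * c.M₂ := by positivity
  have hl : 0 ≤ Real.log c.M₁ := Real.log_nonneg (by exact_mod_cast p1)
  have hm := mul_le_mul_of_nonneg_left hc hl
  refine le_of_mul_le_mul_left ?_ hW
  linarith

theorem rate₂_bound
    (h1 : ∀ m₁ m₂ t, Integrable (fun z => c.input₁ m₁ m₂ z t ^ 2) (noiseLaw n N))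
    (h2 : ∀ m₁ m₂ t, Integrable (fun z => c.input₂ m₁ m₂ z t ^ 2) (noiseLaw n N))
    (hN : 0 < N) {s : ℝ} (hs : 0 < s) (α : ℝ)
    (hE : c.energy N α 1 ≤ n * (c.M₁ * c.M₂) * (s - N)) :
    (1 - c.errorProb N) * Real.log c.M₂ ≤ n / 2 * Real.log (s / N) + Real.log 2 := by
  obtain ⟨p1, p2⟩ := c.card_pos
  have : Nonempty (Fin c.M₂) := ⟨(c.dec 0).2⟩
  have h := Finset.sum_le_sum fun m₁ (_ : m₁ ∈ Finset.univ) =>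
    c.fano hN hs α 1 h1 h2 (fun m₂ : Fin c.M₂ => (m₁, m₂))
    (fun i j => by funext t p; simp [center]) (E := fun m₂ => c.dec ⁻¹' {p | p.2 = m₂})
    (fun m => c.measurableSet_dec_preimage _)
    (fun i j hij => Disjoint.preimage _
      (Set.disjoint_left.2 fun p hp hq => hij (hp.symm.trans hq)))
  rw [← Finset.mul_sum, Finset.sum_add_distrib] at h
  simp only [Fintype.card_fin, Finset.sum_const, Finset.card_univ, nsmul_eq_mul] at h
  have hb := sum_logRatio_bound (l := Real.log (s / N)) hs hE
  have hc : (c.M₁ : ℝ) * c.M₂ * (1 - c.errorProb N) ≤ ∑ m₁, ∑ m₂,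
      (noiseLaw n N).real (c.received m₁ m₂ ⁻¹' (c.dec ⁻¹' {p | p.2 = m₂})) := by
    rw [← sum_prob_correct]
    refine Finset.sum_le_sum fun m₁ _ => Finset.sum_le_sum fun m₂ _ => measureReal_mono ?_
    exact Set.preimage_mono (Set.preimage_mono fun p hp => by simp_all)
  have hW : (0 : ℝ) < c.M₁ * c.M₂ := by positivity
  have hl : 0 ≤ Real.log c.M₂ := Real.log_nonneg (by exact_mod_cast p2)
  have hm := mul_le_mul_of_nonneg_left hc hl
  refine le_of_mul_le_mul_left ?_ hW
  linarith

end

theorem sum_le_of_powerConstraint {N P : ℝ} (hn : 0 < n)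
    {X : Fin c.M₁ → Fin c.M₂ → (Fin n → ℝ) → Fin n → ℝ} (h : c.PowerConstraint N P X) :
    ∑ m₁, ∑ m₂, ∑ t, ∫ z, X m₁ m₂ z t ^ 2 ∂noiseLaw n N ≤ n * (c.M₁ * c.M₂) * P := by
  obtain ⟨p1, p2⟩ := c.card_pos
  have h := h.2
  have hn' : (0 : ℝ) < n := by exact_mod_cast hn
  have hW : (0 : ℝ) < c.M₁ * c.M₂ := by positivity
  rw [← Finset.mul_sum, ← mul_assoc, div_mul_div_comm, one_mul, div_mul_eq_mul_div, one_mul,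
    div_le_iff₀ (by positivity), mul_comm P] at h
  refine le_trans (le_of_eq ?_) h
  rw [Finset.sum_comm (s := Finset.univ (α := Fin n))]
  refine Finset.sum_congr rfl fun m₁ _ => ?_
  rw [Finset.sum_comm]

/-- Ozarow's outer bound for a single code. -/
theorem outer_bound {P₁ P₂ N : ℝ} (hP₁ : 0 < P₁) (hP₂ : 0 < P₂) (hN : 0 < N) (hn : 0 < n)
    (h1 : c.PowerConstraint N P₁ c.input₁) (h2 : c.PowerConstraint N P₂ c.input₂) :
    ∃ ρ ∈ Set.Icc (0 : ℝ) 1,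
      (1 - c.errorProb N) * Real.log c.M₁ ≤
        n / 2 * Real.log (1 + P₁ * (1 - ρ ^ 2) / N) + Real.log 2 ∧
      (1 - c.errorProb N) * Real.log c.M₂ ≤
        n / 2 * Real.log (1 + P₂ * (1 - ρ ^ 2) / N) + Real.log 2 ∧
      (1 - c.errorProb N) * (Real.log c.M₁ + Real.log c.M₂) ≤
        n / 2 * Real.log (1 + (P₁ + P₂ + 2 * √(P₁ * P₂) * ρ) / N) + Real.log 2 := by
  obtain ⟨p1, p2⟩ := c.card_pos
  have hn' : (0 : ℝ) < n := by exact_mod_cast hn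
  have e1 : c.energy N 1 0 ≤ n * (c.M₁ * c.M₂) * P₁ := by
    simpa [energy] using c.sum_le_of_powerConstraint hn h1
  have e2 : c.energy N 0 1 ≤ n * (c.M₁ * c.M₂) * P₂ := by
    simpa [energy] using c.sum_le_of_powerConstraint hn h2
  have hq := c.energy_eq h1.1 h2.1
  have hb1 := fun {s : ℝ} => c.rate₁_bound h1.1 h2.1 hN (s := s)
  have hb2 := fun {s : ℝ} => c.rate₂_bound h1.1 h2.1 hN (s := s)
  have hb3 := fun {s : ℝ} => c.sumRate_bound h1.1 h2.1 hN (s := s)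
  have hnn := c.energy_nonneg (N := N)
  have hV : (0 : ℝ) < n * (c.M₁ * c.M₂) := by positivity
  set V : ℝ := n * (c.M₁ * c.M₂)
  set q := c.crossEnergy N
  obtain ⟨r₁, hr₁, rfl⟩ : ∃ r : ℝ, 0 < r ∧ r ^ 2 = P₁ :=
    ⟨√P₁, Real.sqrt_pos.2 hP₁, Real.sq_sqrt hP₁.le⟩
  obtain ⟨r₂, hr₂, rfl⟩ : ∃ r : ℝ, 0 < r ∧ r ^ 2 = P₂ :=
    ⟨√P₂, Real.sqrt_pos.2 hP₂, Real.sq_sqrt hP₂.le⟩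
  have hsq : √(r₁ ^ 2 * r₂ ^ 2) = r₁ * r₂ := by
    rw [← mul_pow, Real.sqrt_sq (by positivity)]
  rw [hsq]
  -- Cauchy–Schwarz, from the nonnegative energy of r₂X₁ - r₁X₂.
  have hqle : q ≤ V * (r₁ * r₂) := by
    have := hnn r₂ (-r₁)
    rw [hq] at this
    have a1 := mul_le_mul_of_nonneg_left e1 (sq_nonneg r₂)
    have a2 := mul_le_mul_of_nonneg_left e2 (sq_nonneg r₁)
    have : (r₁ * r₂) * q ≤ (r₁ * r₂) * (V * (r₁ * r₂)) := by nlinarith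
    exact le_of_mul_le_mul_left this (by positivity)
  set ρ := max 0 (q / (V * (r₁ * r₂))) with hρ
  have hρ0 : 0 ≤ ρ := le_max_left _ _
  have hρ1 : ρ ≤ 1 := max_le zero_le_one ((div_le_one (by positivity)).2 hqle)
  have hq1 : q ≤ V * (r₁ * r₂) * ρ := by
    have := le_max_right 0 (q / (V * (r₁ * r₂)))
    rwa [div_le_iff₀ (by positivity), mul_comm] at this
  have hq2 : ρ * q = V * (r₁ * r₂) * ρ ^ 2 := by
    rcases le_total (q / (V * (r₁ * r₂))) 0 with h | h
    · have : ρ = 0 := max_eq_left h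
      rw [this]
      ring
    · have hh : ρ = q / (V * (r₁ * r₂)) := max_eq_right h
      have : q = V * (r₁ * r₂) * ρ := by rw [hh]; field_simp
      nth_rw 1 [this]
      ring
  have hτ : 0 ≤ 1 - ρ ^ 2 := by nlinarith
  refine ⟨ρ, ⟨hρ0, hρ1⟩, ?_, ?_, ?_⟩
  · rw [show 1 + r₁ ^ 2 * (1 - ρ ^ 2) / N = (N + r₁ ^ 2 * (1 - ρ ^ 2)) / N by field_simp]
    -- This β subtracts the linear estimate of X₁ from X₂ at correlation ρ, leaving mean energy at
    -- most P₁(1-ρ²).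
    refine hb1 (by positivity) (-(ρ * (r₁ / r₂))) ?_
    rw [hq]
    have a : (ρ * (r₁ / r₂)) ^ 2 * c.energy N 0 1 ≤ (ρ * (r₁ / r₂)) ^ 2 * (V * r₂ ^ 2) := by
      gcongr
    have b : (ρ * (r₁ / r₂)) ^ 2 * (V * r₂ ^ 2) = V * r₁ ^ 2 * ρ ^ 2 := by field_simp
    have d : ρ * (r₁ / r₂) * q = V * r₁ ^ 2 * ρ ^ 2 := by
      rw [mul_right_comm, hq2]
      field_simp
    nlinarith
  · rw [show 1 + r₂ ^ 2 * (1 - ρ ^ 2) / N = (N + r₂ ^ 2 * (1 - ρ ^ 2)) / N by field_simp]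
    refine hb2 (by positivity) (-(ρ * (r₂ / r₁))) ?_
    rw [hq]
    have a : (ρ * (r₂ / r₁)) ^ 2 * c.energy N 1 0 ≤ (ρ * (r₂ / r₁)) ^ 2 * (V * r₁ ^ 2) := by
      gcongr
    have b : (ρ * (r₂ / r₁)) ^ 2 * (V * r₁ ^ 2) = V * r₂ ^ 2 * ρ ^ 2 := by field_simp
    have d : ρ * (r₂ / r₁) * q = V * r₂ ^ 2 * ρ ^ 2 := by
      rw [mul_right_comm, hq2]
      field_simp
    nlinarith
  · rw [show 1 + (r₁ ^ 2 + r₂ ^ 2 + 2 * (r₁ * r₂) * ρ) / N =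
      (N + (r₁ ^ 2 + r₂ ^ 2 + 2 * (r₁ * r₂) * ρ)) / N by field_simp]
    refine hb3 (by positivity) ?_
    rw [hq]
    nlinarith

end FeedbackCode

/-- Ozarow's outer bound on the capacity region with perfect feedback. -/
theorem exists_mem_ozarowRegion {P₁ P₂ N : ℝ} (hP₁ : 0 < P₁) (hP₂ : 0 < P₂) (hN : 0 < N)
    {R : ℝ × ℝ} (hR : R ∈ perfectFeedbackCapacity P₁ P₂ N) :
    ∃ ρ ∈ Set.Icc (0 : ℝ) 1, R ∈ ozarowRegion P₁ P₂ N ρ := by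
  obtain ⟨hR1, hR2, hc⟩ := hR
  let δ : ℕ → ℝ := fun k => 1 / ((k : ℝ) + 1)
  have hδ0 : ∀ k, 0 < δ k := fun k => by simp only [δ]; positivity
  have hδ1 : ∀ k, δ k ≤ 1 := fun k => by
    simp only [δ]
    rw [div_le_one (by positivity)]
    linarith [(k.cast_nonneg : (0 : ℝ) ≤ k)]
  have hδl : Tendsto δ atTop (𝓝 0) := tendsto_one_div_add_atTop_nhds_zero_nat
  have step : ∀ k : ℕ, ∃ ρ ∈ Set.Icc (0 : ℝ) 1,
      (1 - δ k) * (R.1 - δ k) ≤ 1 / 2 * Real.log (1 + P₁ * (1 - ρ ^ 2) / N) + δ k * Real.log 2 ∧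
      (1 - δ k) * (R.2 - δ k) ≤ 1 / 2 * Real.log (1 + P₂ * (1 - ρ ^ 2) / N) + δ k * Real.log 2 ∧
      (1 - δ k) * (R.1 + R.2 - 2 * δ k) ≤
        1 / 2 * Real.log (1 + (P₁ + P₂ + 2 * √(P₁ * P₂) * ρ) / N) + δ k * Real.log 2 := by
    intro k
    -- The single parameter δ k bounds the rate loss, the error probability and, through n ≥ k+1,
    -- the residual (log 2)/n.
    obtain ⟨n, ⟨c, h1, h2, r1, r2, he⟩, hn⟩ :=
      ((hc (δ k) (hδ0 k) (δ k) (hδ0 k)).and (eventually_ge_atTop (k + 1))).exists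
    have hn0 : 0 < n := by omega
    have hn' : (0 : ℝ) < n := by exact_mod_cast hn0
    obtain ⟨ρ, hρ, b1, b2, b3⟩ := c.outer_bound hP₁ hP₂ hN hn0 h1 h2
    obtain ⟨p1, p2⟩ := c.card_pos
    have l1 : 0 ≤ Real.log c.M₁ := Real.log_nonneg (by exact_mod_cast p1)
    have l2 : 0 ≤ Real.log c.M₂ := Real.log_nonneg (by exact_mod_cast p2)
    have hl2 : 0 < Real.log 2 := Real.log_pos (by norm_num)
    have hnk : 1 / (n : ℝ) ≤ δ k := by
      simp only [δ]
      gcongr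
      exact_mod_cast hn
    have fin : ∀ r L U : ℝ, r ≤ 1 / (n : ℝ) * L → 0 ≤ L →
        (1 - c.errorProb N) * L ≤ n / 2 * U + Real.log 2 →
        (1 - δ k) * r ≤ 1 / 2 * U + δ k * Real.log 2 := by
      intro r L U hr hL hb
      have s1 : (1 - δ k) * r ≤ (1 - δ k) * (1 / (n : ℝ) * L) :=
        mul_le_mul_of_nonneg_left hr (by linarith [hδ1 k])
      have s2 : (1 - δ k) * L ≤ (1 - c.errorProb N) * L :=
        mul_le_mul_of_nonneg_right (by linarith) hL
      have s3 : 1 / (n : ℝ) * ((1 - δ k) * L) ≤ 1 / (n : ℝ) * (n / 2 * U + Real.log 2) :=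
        mul_le_mul_of_nonneg_left (s2.trans hb) (by positivity)
      have s4 : 1 / (n : ℝ) * (n / 2 * U + Real.log 2) = 1 / 2 * U + 1 / (n : ℝ) * Real.log 2 := by
        field_simp
      have s5 : 1 / (n : ℝ) * Real.log 2 ≤ δ k * Real.log 2 := by gcongr
      calc (1 - δ k) * r ≤ 1 / (n : ℝ) * ((1 - δ k) * L) := by linarith
        _ ≤ _ := by linarith
    exact ⟨ρ, hρ, fin _ _ _ r1.le l1 b1, fin _ _ _ r2.le l2 b2,
      fin _ _ _ (by linarith) (add_nonneg l1 l2) b3⟩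
  choose ρ hρ b1 b2 b3 using step
  -- The correlation varies with the code; compactness supplies one that serves all three bounds in
  -- the limit.
  obtain ⟨ρ₀, hρ₀, φ, hφ, hlim⟩ := isCompact_Icc.tendsto_subseq hρ
  have hδφ := hδl.comp hφ.tendsto_atTop
  have hτ : 0 ≤ 1 - ρ₀ ^ 2 := by nlinarith [hρ₀.1, hρ₀.2]
  have hsub : Tendsto (fun k => 1 - δ (φ k)) atTop (𝓝 1) := by
    simpa using hδφ.const_sub 1
  have hl2 : Tendsto (fun k => δ (φ k) * Real.log 2) atTop (𝓝 0) := by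
    simpa using hδφ.mul_const (Real.log 2)
  have hlog : ∀ f : ℝ → ℝ, Continuous f → 0 < f ρ₀ → Tendsto (fun k =>
      1 / 2 * Real.log (f (ρ (φ k))) + δ (φ k) * Real.log 2) atTop
      (𝓝 (1 / 2 * Real.log (f ρ₀))) := by
    intro f hf hpos
    have h1 : Tendsto (fun k => f (ρ (φ k))) atTop (𝓝 (f ρ₀)) := (hf.tendsto ρ₀).comp hlim
    have h2 := ((h1.log hpos.ne').const_mul (1 / 2)).add hl2
    rwa [add_zero] at h2
  have hleft : ∀ r a : ℝ, Tendsto (fun k => (1 - δ (φ k)) * (r - a * δ (φ k))) atTop (𝓝 r) := by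
    intro r a
    simpa using hsub.mul ((hδφ.const_mul a).const_sub r)
  refine ⟨ρ₀, hρ₀, hR1, hR2, ?_, ?_, ?_⟩
  · refine le_of_tendsto_of_tendsto' (hleft R.1 1)
      (hlog (fun ρ => 1 + P₁ * (1 - ρ ^ 2) / N) (by fun_prop) (by positivity)) fun k => ?_
    rw [one_mul]
    exact b1 (φ k)
  · refine le_of_tendsto_of_tendsto' (hleft R.2 1)
      (hlog (fun ρ => 1 + P₂ * (1 - ρ ^ 2) / N) (by fun_prop) (by positivity)) fun k => ?_
    rw [one_mul]
    exact b2 (φ k)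
  · have := hρ₀.1
    exact le_of_tendsto_of_tendsto' (hleft (R.1 + R.2) 2)
      (hlog (fun ρ => 1 + (P₁ + P₂ + 2 * √(P₁ * P₂) * ρ) / N) (by fun_prop) (by positivity))
      fun k => b3 (φ k)

/-- The dominant corner point is the only possible point of maximum sum-rate. -/
theorem sumRate_lt_of_ne_ozarowCorner {P₁ P₂ N : ℝ} (hP₁ : 0 < P₁) (hP₂ : 0 < P₂) (hN : 0 < N)
    {R : ℝ × ℝ} (hR : R ∈ perfectFeedbackCapacity P₁ P₂ N) (hne : R ≠ ozarowCorner P₁ P₂ N) :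
    R.1 + R.2 < (ozarowCorner P₁ P₂ N).1 + (ozarowCorner P₁ P₂ N).2 := by
  obtain ⟨ρ, hρ, -, -, h1, h2, h3⟩ := exists_mem_ozarowRegion hP₁ hP₂ hN hR
  obtain ⟨hI, he⟩ := rhoStar_spec hP₁ hP₂ hN
  have hsum := (ozarowCorner_mem_ozarowRegion hP₁ hP₂ hN).2
  have hs : 0 < √(P₁ * P₂) := Real.sqrt_pos.2 (mul_pos hP₁ hP₂)
  rcases lt_trichotomy ρ (rhoStar P₁ P₂ N) with h | h | h
  · rw [hsum]
    refine h3.trans_lt ?_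
    have := hρ.1
    have hpos : 0 < 1 + (P₁ + P₂ + 2 * √(P₁ * P₂) * ρ) / N := by positivity
    gcongr
  · subst h
    by_contra hlt
    refine hne (Prod.ext ?_ ?_)
    · refine le_antisymm h1 ?_
      simp only [ozarowCorner] at hlt ⊢
      linarith
    · refine le_antisymm h2 ?_
      simp only [ozarowCorner] at hlt ⊢
      linarith
  · have hlt : ∀ p : ℝ, 0 < p → 1 / 2 * Real.log (1 + p * (1 - ρ ^ 2) / N) <
        1 / 2 * Real.log (1 + p * (1 - rhoStar P₁ P₂ N ^ 2) / N) := by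
      intro p hp
      have := hI.1
      have : 0 ≤ 1 - ρ ^ 2 := by nlinarith [hρ.1, hρ.2]
      have hpos : 0 < 1 + p * (1 - ρ ^ 2) / N := by positivity
      gcongr
    have := hlt P₁ hP₁
    have := hlt P₂ hP₂
    simp only [ozarowCorner]
    linarith

/-! ### Linear functionals of the noise -/

section Noise

variable {n : ℕ}

theorem integral_noise_mul (N : ℝ) (hN : 0 < N) (s t : Fin n) :
    ∫ z, z s * z t ∂noiseLaw n N = if s = t then N else 0 := by
  split_ifs with h
  · subst h
    simpa [sq] using integral_noise_sq hN s
  · exact integral_mul_noise_eq_zero N t (measurable_pi_apply s)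
      fun z => Function.update_of_ne h _ _

theorem integral_noise (N : ℝ) (t : Fin n) : ∫ z, z t ∂noiseLaw n N = 0 := by
  simpa using integral_mul_noise_eq_zero N t (D := fun _ => 1) measurable_const fun _ => rfl

theorem integrable_affine_noise_sq (N b : ℝ) (f : Fin n → ℝ) :
    Integrable (fun z : Fin n → ℝ => (b + ∑ s, f s * z s) ^ 2) (noiseLaw n N) :=
  MemLp.integrable_sq ((memLp_const b).add
    (memLp_finsetSum _ fun s _ => (memLp_noise N s).const_mul (f s)))

theorem integral_affine_noise_sq {N : ℝ} (hN : 0 < N) (b : ℝ) (f : Fin n → ℝ) :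
    ∫ z, (b + ∑ s, f s * z s) ^ 2 ∂noiseLaw n N = b ^ 2 + N * ∑ s, f s ^ 2 := by
  have hi : ∀ s, Integrable (fun z : Fin n → ℝ => z s) (noiseLaw n N) := fun s =>
    (memLp_noise N s).integrable one_le_two
  have hii : ∀ s t, Integrable (fun z : Fin n → ℝ => z s * z t) (noiseLaw n N) := fun s t =>
    (memLp_noise N s).integrable_mul (memLp_noise N t)
  have e : ∀ z : Fin n → ℝ, (b + ∑ s, f s * z s) ^ 2 = b ^ 2 + (∑ s, 2 * b * f s * z s +
      ∑ s, ∑ t, f s * f t * (z s * z t)) := by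
    intro z
    have : ∑ s, ∑ t, f s * f t * (z s * z t) = (∑ s, f s * z s) * ∑ s, f s * z s := by
      rw [Finset.sum_mul_sum]
      exact Finset.sum_congr rfl fun s _ => Finset.sum_congr rfl fun t _ => by ring
    have h2 : ∑ s, 2 * b * f s * z s = 2 * b * ∑ s, f s * z s := by
      rw [Finset.mul_sum]
      exact Finset.sum_congr rfl fun s _ => by ring
    rw [this, h2]
    ring
  have i1 : Integrable (fun z : Fin n → ℝ => ∑ s, 2 * b * f s * z s) (noiseLaw n N) :=
    integrable_finsetSum _ fun s _ => (hi s).const_mul _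
  have i2 : ∀ s, Integrable (fun z : Fin n → ℝ => ∑ t, f s * f t * (z s * z t)) (noiseLaw n N) :=
    fun s => integrable_finsetSum _ fun t _ => (hii s t).const_mul _
  have i3 : Integrable (fun z : Fin n → ℝ => ∑ s, ∑ t, f s * f t * (z s * z t))
      (noiseLaw n N) := integrable_finsetSum _ fun s _ => i2 s
  have i4 : Integrable (fun z : Fin n → ℝ => ∑ s, 2 * b * f s * z s +
      ∑ s, ∑ t, f s * f t * (z s * z t)) (noiseLaw n N) := i1.add i3
  simp only [e]
  rw [integral_add (integrable_const _) i4, integral_add i1 i3,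
    integral_finsetSum _ fun s _ => (hi s).const_mul _, integral_finsetSum _ fun s _ => i2 s]
  have e2 : ∀ s, ∫ z : Fin n → ℝ, ∑ t, f s * f t * (z s * z t) ∂noiseLaw n N = N * f s ^ 2 := by
    intro s
    rw [integral_finsetSum _ fun t _ => (hii s t).const_mul _]
    simp only [integral_const_mul, integral_noise_mul N hN]
    simp
    ring
  simp only [e2, integral_const_mul, integral_noise, Finset.mul_sum]
  simp

/-- Chebyshev's inequality suffices, since the estimation variance will decay exponentially faster
than the squared spacing of the points. -/
theorem prob_abs_ge_le {N : ℝ} (hN : 0 < N) (f : Fin n → ℝ) {r : ℝ} (hr : 0 < r) :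
    (noiseLaw n N).real {z | r ≤ |∑ s, f s * z s|} ≤ (N * ∑ s, f s ^ 2) / r ^ 2 := by
  have h := mul_meas_ge_le_integral_of_nonneg (μ := noiseLaw n N)
    (f := fun z => (0 + ∑ s, f s * z s) ^ 2) (Eventually.of_forall fun z => sq_nonneg _)
    (integrable_affine_noise_sq N 0 f) (r ^ 2)
  rw [integral_affine_noise_sq hN] at h
  have hs : {z : Fin n → ℝ | r ^ 2 ≤ (0 + ∑ s, f s * z s) ^ 2} =
      {z | r ≤ |∑ s, f s * z s|} := by
    ext z
    simp only [Set.mem_ofPred_eq, zero_add]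
    rw [sq_le_sq, abs_of_pos hr]
  rw [hs] at h
  rw [le_div_iff₀ (by positivity), mul_comm]
  simpa using h

end Noise

/-! ### Pulse-amplitude modulation -/

/-- The `i`-th of `M` equidistant points of `[-1, 1]`. -/
def pam (M : ℕ) (i : Fin M) : ℝ := (2 * (i : ℕ) + 1) / M - 1

theorem pam_sq_le_one {M : ℕ} (i : Fin M) : pam M i ^ 2 ≤ 1 := by
  have hM : (0 : ℝ) < M := by exact_mod_cast i.pos
  have hi : ((i : ℕ) : ℝ) + 1 ≤ M := by exact_mod_cast i.isLt
  have h0 : (0 : ℝ) ≤ (2 * (i : ℕ) + 1) / M := by positivity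
  have h2 : (2 * ((i : ℕ) : ℝ) + 1) / M ≤ 2 := by
    rw [div_le_iff₀ hM]
    linarith
  rw [pam]
  nlinarith

/-- Centring makes the cross terms vanish in the average power. With squares at most 1, the points
then cost no more than unit-variance messages. -/
theorem sum_pam {M : ℕ} (hM : 0 < M) : ∑ i, pam M i = 0 := by
  have h : ∀ k : ℕ, ∑ i ∈ Finset.range k, (2 * (i : ℝ) + 1) = (k : ℝ) ^ 2 := by
    intro k
    induction k with
    | zero => simp
    | succ k ih =>
      rw [Finset.sum_range_succ, ih]
      push_cast
      ring
  have hM' : (M : ℝ) ≠ 0 := by positivity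
  simp only [pam, Finset.sum_sub_distrib, ← Finset.sum_div]
  rw [Fin.sum_univ_eq_sum_range (fun i => 2 * (i : ℝ) + 1) M, h]
  simp
  field_simp
  ring

theorem sum_pam_sq_le (M : ℕ) : ∑ i, pam M i ^ 2 ≤ M := by
  simpa using Finset.sum_le_sum fun i (_ : i ∈ Finset.univ) => pam_sq_le_one (M := M) i

/-- The message whose point is nearest to the estimate `x`. -/
def pamDecode {M : ℕ} (hM : 0 < M) (x : ℝ) : Fin M :=
  ⟨min (⌊(M : ℝ) * (x + 1) / 2⌋.toNat) (M - 1), by omega⟩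

theorem measurable_pamDecode {M : ℕ} (hM : 0 < M) : Measurable (pamDecode hM) := by
  have h : Measurable fun k : ℤ => (⟨min k.toNat (M - 1), by omega⟩ : Fin M) :=
    measurable_from_top
  exact h.comp (Int.measurable_floor.comp (by fun_prop))

theorem pamDecode_eq {M : ℕ} (hM : 0 < M) (i : Fin M) {e : ℝ} (he : |e| < 1 / M) :
    pamDecode hM (pam M i + e) = i := by
  have hM' : (0 : ℝ) < M := by exact_mod_cast hM
  have hf : ⌊(M : ℝ) * (pam M i + e + 1) / 2⌋ = (i : ℕ) := by
    have hx : (M : ℝ) * (pam M i + e + 1) / 2 = (i : ℕ) + 1 / 2 + e * M / 2 := by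
      rw [pam]
      field_simp
      ring
    rw [lt_div_iff₀ hM', ← abs_of_pos hM', ← abs_mul, abs_lt] at he
    rw [hx, Int.floor_eq_iff]
    push_cast
    constructor <;> linarith [he.1, he.2]
  apply Fin.ext
  simp only [pamDecode, hf, Int.toNat_natCast]
  omega

/-! ### Linear feedback codes -/

section LinearCode

variable {n : ℕ}

theorem sum_castLE_of_strictLower {b : Fin n → ℝ} (t : Fin n) (hb : ∀ s, t ≤ s → b s = 0) :
    ∑ j : Fin t, b (Fin.castLE t.isLt.le j) = ∑ s, b s := by
  rw [← Finset.sum_subset (Finset.subset_univ (Finset.univ.map (Fin.castLEEmb t.isLt.le)))]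
  · simp
  · intro s _ hs
    refine hb s (not_lt.1 fun hlt => hs ?_)
    exact Finset.mem_map.2 ⟨⟨s, hlt⟩, Finset.mem_univ _, rfl⟩

/-- The feedback code that sends `a_ν θ_ν + B_ν Y` with a modulated message `θ_ν`, and decodes by
the linear estimates with coefficients `w_ν`. -/
def linearCode (a : Fin 2 → Fin n → ℝ) (B : Fin 2 → Matrix (Fin n) (Fin n) ℝ)
    (w : Fin 2 → Fin n → ℝ) (M : Fin 2 → ℕ) (hM : ∀ ν, 0 < M ν) : FeedbackCode n where
  M₁ := M 0
  M₂ := M 1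
  enc₁ t i p := a 0 t * pam (M 0) i + ∑ j : Fin t, B 0 t (Fin.castLE t.isLt.le j) * p j
  enc₂ t i p := a 1 t * pam (M 1) i + ∑ j : Fin t, B 1 t (Fin.castLE t.isLt.le j) * p j
  dec y := (pamDecode (hM 0) (w 0 ⬝ᵥ (1 - (B 0 + B 1)).mulVec y),
    pamDecode (hM 1) (w 1 ⬝ᵥ (1 - (B 0 + B 1)).mulVec y))
  measurable_enc₁ t i := by fun_prop
  measurable_enc₂ t i := by fun_prop
  measurable_dec := by
    have h : ∀ ν, Measurable fun y : Fin n → ℝ => w ν ⬝ᵥ (1 - (B 0 + B 1)).mulVec y := fun ν => by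
      simp only [dotProduct, Matrix.mulVec]
      fun_prop
    exact ((measurable_pamDecode (hM 0)).comp (h 0)).prodMk
      ((measurable_pamDecode (hM 1)).comp (h 1))

variable {a : Fin 2 → Fin n → ℝ} {F : Fin 2 → Matrix (Fin n) (Fin n) ℝ} {w : Fin 2 → Fin n → ℝ}
  {M : Fin 2 → ℕ} {hM : ∀ ν, 0 < M ν}

theorem linearCode_received (hF : ∀ ν i j, i ≤ j → F ν i j = 0) (i : Fin (M 0)) (j : Fin (M 1))
    (z : Fin n → ℝ) :
    (linearCode a (feedbackMatrix F) w M hM).received i j z =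
      (1 + (F 0 + F 1)).mulVec (pam (M 0) i • a 0 + pam (M 1) j • a 1 + z) := by
  obtain ⟨-, h3⟩ := one_sub_feedbackMatrix hF
  set v := pam (M 0) i • a 0 + pam (M 1) j • a 1 + z with hv
  refine FeedbackCode.received_eq_of_forall _ _ _ fun t => ?_
  have hB : ∀ ν, ∑ j : Fin t, feedbackMatrix F ν t (Fin.castLE t.isLt.le j) *
      past ((1 + (F 0 + F 1)).mulVec v) t j = (F ν).mulVec v t := by
    intro ν
    rw [← h3 ν, ← Matrix.mulVec_mulVec]
    exact sum_castLE_of_strictLower (b := fun s => feedbackMatrix F ν t s *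
      (1 + (F 0 + F 1)).mulVec v s) t fun s hs => by
        rw [feedbackMatrix_strictLower hF ν hs, zero_mul]
  simp only [FeedbackCode.totalInput, linearCode, hB]
  rw [Matrix.add_mulVec, Matrix.add_mulVec, Matrix.one_mulVec]
  simp only [hv, Pi.add_apply, Pi.smul_apply, smul_eq_mul]
  ring

/-- This exhibits each input as an affine function of the noise with the coefficients that enter
`linearPower`. -/
theorem linearCode_feedback (hF : ∀ ν i j, i ≤ j → F ν i j = 0) (i : Fin (M 0)) (j : Fin (M 1))
    (z : Fin n → ℝ) (ν : Fin 2) (t : Fin n) :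
    a ν t * ![pam (M 0) i, pam (M 1) j] ν + ∑ s : Fin t,
      feedbackMatrix F ν t (Fin.castLE t.isLt.le s) *
        (linearCode a (feedbackMatrix F) w M hM).output i j z t t.isLt.le s =
      ∑ μ, ((if ν = μ then a μ t else 0) + ∑ s, F ν t s * a μ s) *
        ![pam (M 0) i, pam (M 1) j] μ + ∑ s, F ν t s * z s := by
  obtain ⟨-, h3⟩ := one_sub_feedbackMatrix hF
  have hp : (linearCode a (feedbackMatrix F) w M hM).output i j z t t.isLt.le =
      past ((1 + (F 0 + F 1)).mulVec (pam (M 0) i • a 0 + pam (M 1) j • a 1 + z)) t :=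
    ((linearCode a (feedbackMatrix F) w M hM).past_received i j z t).symm.trans
      (congrArg (fun y => past y t) (linearCode_received hF i j z))
  rw [hp]
  set v := pam (M 0) i • a 0 + pam (M 1) j • a 1 + z with hv
  have hB : ∑ j : Fin t, feedbackMatrix F ν t (Fin.castLE t.isLt.le j) *
      past ((1 + (F 0 + F 1)).mulVec v) t j = (F ν).mulVec v t := by
    rw [← h3 ν, ← Matrix.mulVec_mulVec]
    exact sum_castLE_of_strictLower (b := fun s => feedbackMatrix F ν t s *
      (1 + (F 0 + F 1)).mulVec v s) t fun s hs => by
        rw [feedbackMatrix_strictLower hF ν hs, zero_mul]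
  rw [hB, hv, Matrix.mulVec_add, Matrix.mulVec_add, Matrix.mulVec_smul, Matrix.mulVec_smul]
  simp only [Pi.add_apply, Pi.smul_apply, smul_eq_mul, Fin.sum_univ_two, Matrix.mulVec, dotProduct]
  fin_cases ν <;> simp <;> ring

theorem average_pam_sq_le {M₁ M₂ : ℕ} (h₁ : 0 < M₁) (h₂ : 0 < M₂) (α β V : ℝ) :
    1 / ((M₁ : ℝ) * M₂) * ∑ i, ∑ j, ((α * pam M₁ i + β * pam M₂ j) ^ 2 + V) ≤
      α ^ 2 + β ^ 2 + V := by
  have e : ∑ i, ∑ j, ((α * pam M₁ i + β * pam M₂ j) ^ 2 + V) =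
      α ^ 2 * (M₂ * ∑ i, pam M₁ i ^ 2) + 2 * α * β * ((∑ i, pam M₁ i) * ∑ j, pam M₂ j) +
        β ^ 2 * (M₁ * ∑ j, pam M₂ j ^ 2) + M₁ * M₂ * V := by
    have : ∀ i j, (α * pam M₁ i + β * pam M₂ j) ^ 2 + V = α ^ 2 * pam M₁ i ^ 2 +
      2 * α * β * (pam M₁ i * pam M₂ j) + β ^ 2 * pam M₂ j ^ 2 + V := fun i j => by ring
    simp only [this, Finset.sum_add_distrib, ← Finset.mul_sum, Finset.sum_const, Finset.card_univ,
      Fintype.card_fin, nsmul_eq_mul, Finset.sum_mul_sum]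
    ring
  have hp : (0 : ℝ) < (M₁ : ℝ) * M₂ := by positivity
  rw [e, sum_pam h₁, one_div, inv_mul_le_iff₀ hp]
  have a1 : α ^ 2 * (M₂ * ∑ i, pam M₁ i ^ 2) ≤ α ^ 2 * (M₂ * M₁) := by
    gcongr
    exact sum_pam_sq_le M₁
  have a2 : β ^ 2 * (M₁ * ∑ i, pam M₂ i ^ 2) ≤ β ^ 2 * (M₁ * M₂) := by
    gcongr
    exact sum_pam_sq_le M₂
  linarith

theorem linearCode_power {N : ℝ} (hN : 0 < N) (hn : 0 < n) (ν : Fin 2) {P : ℝ} (hP : linearPower N a F ν ≤ n * P)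
    {X : Fin (M 0) → Fin (M 1) → (Fin n → ℝ) → Fin n → ℝ}
    (hX : ∀ i j z t, X i j z t = ∑ μ, ((if ν = μ then a μ t else 0) + ∑ s, F ν t s * a μ s) *
        ![pam (M 0) i, pam (M 1) j] μ + ∑ s, F ν t s * z s) :
    (linearCode a (feedbackMatrix F) w M hM).PowerConstraint N P X := by
  have hI : ∀ i j t, ∫ z, X i j z t ^ 2 ∂noiseLaw n N =
      (((if ν = 0 then a 0 t else 0) + ∑ s, F ν t s * a 0 s) * pam (M 0) i +
        ((if ν = 1 then a 1 t else 0) + ∑ s, F ν t s * a 1 s) * pam (M 1) j) ^ 2 +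
        N * ∑ s, F ν t s ^ 2 := by
    intro i j t
    simp only [hX, integral_affine_noise_sq hN, Fin.sum_univ_two]
    rfl
  refine ⟨fun i j t => ?_, ?_⟩
  · have h := hX i j
    simp only [h]
    exact integrable_affine_noise_sq N _ _
  · have hn' : (0 : ℝ) < n := by exact_mod_cast hn
    rw [one_div, inv_mul_le_iff₀ hn']
    refine le_trans (Finset.sum_le_sum fun t _ => ?_) hP
    refine le_trans (le_of_eq ?_) ((average_pam_sq_le (hM 0) (hM 1)
      ((if ν = 0 then a 0 t else 0) + ∑ s, F ν t s * a 0 s)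
      ((if ν = 1 then a 1 t else 0) + ∑ s, F ν t s * a 1 s) (N * ∑ s, F ν t s ^ 2)).trans_eq ?_)
    · congr 1
      refine Finset.sum_congr rfl fun i _ => Finset.sum_congr rfl fun j _ => ?_
      exact hI i j t
    · rw [Fin.sum_univ_two]

/-- Undoing the feedback, the estimate is the modulated message plus w_ν · z. An error forces |w_ν ·
z| ≥ 1/M_ν, half the spacing, for some ν. -/
theorem linearCode_error {N : ℝ} (hN : 0 < N) (hF : ∀ ν i j, i ≤ j → F ν i j = 0)
    (hw : ∀ ν μ, w ν ⬝ᵥ a μ = if ν = μ then 1 else 0) :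
    (linearCode a (feedbackMatrix F) w M hM).errorProb N ≤
      ∑ ν, (M ν : ℝ) ^ 2 * (N * ∑ s, w ν s ^ 2) := by
  obtain ⟨h1, -⟩ := one_sub_feedbackMatrix hF
  have h0 := hM 0
  have h1' := hM 1
  have hMp : ∀ ν, (0 : ℝ) < M ν := fun ν => by exact_mod_cast hM ν
  set c := linearCode a (feedbackMatrix F) w M hM
  have hdec : ∀ (i : Fin (M 0)) (j : Fin (M 1)) z, c.dec (c.output i j z n le_rfl) =
      (pamDecode h0 (pam (M 0) i + ∑ s, w 0 s * z s),
        pamDecode h1' (pam (M 1) j + ∑ s, w 1 s * z s)) := by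
    intro i j z
    have hr := linearCode_received (a := a) (w := w) (hM := hM) hF i j z
    have e : (1 - (feedbackMatrix F 0 + feedbackMatrix F 1)).mulVec (c.output i j z n le_rfl) =
        pam (M 0) i • a 0 + pam (M 1) j • a 1 + z := by
      rw [show c.output i j z n le_rfl = _ from hr, Matrix.mulVec_mulVec, h1, Matrix.one_mulVec]
    have hd : ∀ y, c.dec y = (pamDecode h0 (w 0 ⬝ᵥ
      (1 - (feedbackMatrix F 0 + feedbackMatrix F 1)).mulVec y), pamDecode h1' (w 1 ⬝ᵥ
      (1 - (feedbackMatrix F 0 + feedbackMatrix F 1)).mulVec y)) := fun y => rfl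
    rw [hd, e]
    simp only [dotProduct_add, dotProduct_smul, hw]
    simp [dotProduct]
    rfl
  have hle : ∀ (i : Fin (M 0)) (j : Fin (M 1)),
      (noiseLaw n N).real {z | c.dec (c.output i j z n le_rfl) ≠ (i, j)} ≤
        ∑ ν, (M ν : ℝ) ^ 2 * (N * ∑ s, w ν s ^ 2) := by
    intro i j
    have hsub : {z | c.dec (c.output i j z n le_rfl) ≠ (i, j)} ⊆
        {z | 1 / (M 0 : ℝ) ≤ |∑ s, w 0 s * z s|} ∪ {z | 1 / (M 1 : ℝ) ≤ |∑ s, w 1 s * z s|} := by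
      intro z hz
      by_contra hcon
      simp only [Set.mem_union, Set.mem_ofPred_eq, not_or, not_le] at hcon
      refine hz ?_
      rw [hdec, pamDecode_eq h0 i hcon.1, pamDecode_eq h1' j hcon.2]
    refine (measureReal_mono hsub).trans ((measureReal_union_le _ _).trans ?_)
    rw [Fin.sum_univ_two]
    have hb : ∀ ν, (noiseLaw n N).real {z | 1 / (M ν : ℝ) ≤ |∑ s, w ν s * z s|} ≤
        (M ν : ℝ) ^ 2 * (N * ∑ s, w ν s ^ 2) := fun ν => by
      have hm := hMp ν
      refine (prob_abs_ge_le hN (w ν) (by positivity)).trans_eq ?_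
      field_simp
    exact add_le_add (hb 0) (hb 1)
  have hp : (0 : ℝ) < (M 0 : ℝ) * M 1 := mul_pos (hMp 0) (hMp 1)
  have hsum := Finset.sum_le_sum fun i (_ : i ∈ Finset.univ) =>
    Finset.sum_le_sum fun j (_ : j ∈ Finset.univ) => hle i j
  simp only [Finset.sum_const, Finset.card_univ, Fintype.card_fin, nsmul_eq_mul] at hsum
  change 1 / ((M 0 : ℝ) * M 1) * _ ≤ _
  rw [one_div, inv_mul_le_iff₀ hp, mul_assoc]
  exact hsum

end LinearCode

/-! ### Achievability of the dominant corner point -/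

/-- Zero-forcing estimates of two messages. -/
theorem exists_zeroForcing {n : ℕ} (a : Fin 2 → Fin n → ℝ)
    (hD : 0 < (∑ s, a 0 s * a 0 s) * (∑ s, a 1 s * a 1 s) - (∑ s, a 0 s * a 1 s) ^ 2) :
    ∃ w : Fin 2 → Fin n → ℝ, (∀ ν μ, w ν ⬝ᵥ a μ = if ν = μ then 1 else 0) ∧
      ∑ s, w 0 s ^ 2 = (∑ s, a 1 s * a 1 s) /
        ((∑ s, a 0 s * a 0 s) * (∑ s, a 1 s * a 1 s) - (∑ s, a 0 s * a 1 s) ^ 2) ∧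
      ∑ s, w 1 s ^ 2 = (∑ s, a 0 s * a 0 s) /
        ((∑ s, a 0 s * a 0 s) * (∑ s, a 1 s * a 1 s) - (∑ s, a 0 s * a 1 s) ^ 2) := by
  set A := ∑ s, a 0 s * a 0 s with hA
  set B := ∑ s, a 1 s * a 1 s with hB
  set G := ∑ s, a 0 s * a 1 s with hG
  set D := A * B - G ^ 2
  have hlin : ∀ (x y : ℝ) (u : Fin n → ℝ), ∑ s, (x * a 0 s + y * a 1 s) * u s =
      x * ∑ s, a 0 s * u s + y * ∑ s, a 1 s * u s := by
    intro x y u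
    rw [Finset.mul_sum, Finset.mul_sum, ← Finset.sum_add_distrib]
    exact Finset.sum_congr rfl fun s _ => by ring
  have hsq : ∀ x y : ℝ, ∑ s, (x * a 0 s + y * a 1 s) ^ 2 =
      x ^ 2 * A + 2 * x * y * G + y ^ 2 * B := by
    intro x y
    rw [hA, hB, hG, Finset.mul_sum, Finset.mul_sum, Finset.mul_sum, ← Finset.sum_add_distrib,
      ← Finset.sum_add_distrib]
    exact Finset.sum_congr rfl fun s _ => by ring
  have hG' : ∑ s, a 1 s * a 0 s = G := by simp only [hG, mul_comm (a 1 _)]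
  have hDe : D = A * B - G ^ 2 := rfl
  -- The dual basis of the amplitudes in their span: its coefficients are the rows of the inverse
  -- Gram matrix, whose diagonal gives the squared norms.
  refine ⟨![fun s => B / D * a 0 s + -G / D * a 1 s, fun s => -G / D * a 0 s + A / D * a 1 s],
    ?_, ?_, ?_⟩
  · intro ν μ
    fin_cases ν <;> fin_cases μ <;> simp [dotProduct, hlin, ← hA, ← hB, ← hG, hG'] <;>
      field_simp <;> rw [hDe] <;> ring
  · simp only [Matrix.cons_val_zero, hsq]
    field_simp
    rw [hDe]
    ring
  · simp only [Matrix.cons_val_one, Matrix.cons_val_fin_one, hsq]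
    field_simp
    rw [hDe]
    ring

/-- Since `k` precedes `m`, the blocklengths `m + 1 + k` exhaust all large integers, as the
definition of capacity demands. -/
theorem exists_code {N ρ : ℝ} {P : Fin 2 → ℝ} (hP : ∀ ν, 0 < P ν) (hN : 0 < N)
    (hρ : 0 < ρ) (hρ1 : ρ < 1) (h : RhoEquation (P 0) (P 1) N ρ) :
    ∃ k : ℕ, ∀ m : ℕ, (∀ ν, 4 / (1 - ρ ^ 2) ≤ (1 + P ν * (1 - ρ ^ 2) / N) ^ m / (1 - ρ)) →
      ∀ M : Fin 2 → ℕ, (∀ ν, 0 < M ν) → ∃ c : FeedbackCode (m + 1 + k),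
        c.PowerConstraint N (P 0) c.input₁ ∧ c.PowerConstraint N (P 1) c.input₂ ∧
        c.M₁ = M 0 ∧ c.M₂ = M 1 ∧ c.errorProb N ≤ ∑ ν, (M ν : ℝ) ^ 2 *
          (2 / ((1 - ρ ^ 2) * ((1 + P ν * (1 - ρ ^ 2) / N) ^ m / (1 - ρ)))) := by
  have hτ : 0 < 1 - ρ ^ 2 := by nlinarith
  obtain ⟨k, hk⟩ := exists_linearScheme hP hN hρ hρ1 h
  refine ⟨k, fun m hm M hM => ?_⟩
  obtain ⟨a, F, hF, hpow, hJ, hX⟩ := hk m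
  have hlow := gram_det_lower hτ (hm 0) (hm 1)
  have hpos : ∀ ν, 0 < (1 + P ν * (1 - ρ ^ 2) / N) ^ m / (1 - ρ) := fun ν =>
    lt_of_lt_of_le (by positivity) (hm ν)
  rw [← hX] at hlow
  simp only [← hJ] at hlow hpos ⊢
  set A := ∑ s, a 0 s * a 0 s with hA
  set B := ∑ s, a 1 s * a 1 s with hB
  set G := ∑ s, a 0 s * a 1 s with hG
  have hA0 := hpos 0
  have hB0 := hpos 1
  rw [← hA] at hA0
  rw [← hB] at hB0
  have e : (1 + A / N - 1) * (1 + B / N - 1) - (G / N) ^ 2 = (A * B - G ^ 2) / N ^ 2 := by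
    field_simp
    ring
  rw [e] at hlow
  have hD : 0 < A * B - G ^ 2 := by
    have : 0 < (A * B - G ^ 2) / N ^ 2 := lt_of_lt_of_le (by positivity) hlow
    exact (div_pos_iff_of_pos_right (by positivity)).1 this
  obtain ⟨w, hw, hw0, hw1⟩ := exists_zeroForcing a hD
  have hbound : ∀ x y : ℝ, 0 < 1 + x / N → 0 < 1 + y / N →
      (1 - ρ ^ 2) / 2 * ((1 + x / N) * (1 + y / N)) ≤ (A * B - G ^ 2) / N ^ 2 →
      N * (y / (A * B - G ^ 2)) ≤ 2 / ((1 - ρ ^ 2) * (1 + x / N)) := by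
    intro x y hx hy hxy
    rw [le_div_iff₀ (by positivity), ← mul_div_assoc, div_mul_eq_mul_div, div_le_iff₀ hD]
    rw [le_div_iff₀ (by positivity)] at hxy
    have hyn : y * N ≤ (1 + y / N) * N ^ 2 := by
      have : (1 + y / N) * N ^ 2 = N ^ 2 + y * N := by field_simp
      rw [this]
      nlinarith
    have hc : 0 < (1 - ρ ^ 2) * (1 + x / N) := by positivity
    have := mul_le_mul_of_nonneg_left hyn hc.le
    nlinarith
  refine ⟨linearCode a (feedbackMatrix F) w M hM, ?_, ?_, rfl, rfl, ?_⟩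
  · exact linearCode_power hN (by omega) 0 (hpow 0).le
      fun i j z t => linearCode_feedback hF i j z 0 t
  · exact linearCode_power hN (by omega) 1 (hpow 1).le
      fun i j z t => linearCode_feedback hF i j z 1 t
  · refine (linearCode_error hN hF hw).trans ?_
    rw [Fin.sum_univ_two, Fin.sum_univ_two, hw0, hw1]
    have b0 := hbound A B hA0 hB0 hlow
    have b1 := hbound B A hB0 hA0 (by rwa [mul_comm (1 + B / N)])
    gcongr

/-- The squared message count grows like exp(2mr) and the inverse variance like exp(m log λ), so 2r
< log λ gives exponential decay. -/
theorem tendsto_error_bound {lam ρ r C : ℝ} (k : ℕ) (hl : 0 < lam)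
    (hr : r < 1 / 2 * Real.log lam) :
    Tendsto (fun m : ℕ => (2 * Real.exp (((m + 1 + k : ℕ) : ℝ) * r)) ^ 2 *
      (2 / (C * (lam ^ m / (1 - ρ))))) atTop (𝓝 0) := by
  have hq : Real.exp (2 * r - Real.log lam) < 1 := Real.exp_lt_one_iff.2 (by linarith)
  have h := (tendsto_pow_atTop_nhds_zero_of_lt_one (Real.exp_pos _).le hq).const_mul
    (8 * Real.exp (2 * (1 + k) * r) * (1 - ρ) / C)
  rw [mul_zero] at h
  refine h.congr fun m => ?_
  have e1 : lam ^ m = Real.exp (m * Real.log lam) := by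
    rw [mul_comm, Real.exp_mul, Real.exp_log hl, Real.rpow_natCast]
  have e2 : (2 * Real.exp (((m + 1 + k : ℕ) : ℝ) * r)) ^ 2 =
      4 * Real.exp (2 * (((m + 1 + k : ℕ) : ℝ) * r)) := by
    rw [mul_pow, ← Real.exp_nat_mul]
    norm_num
  rw [e2, ← Real.exp_nat_mul]
  have e3 : Real.exp (2 * (((m + 1 + k : ℕ) : ℝ) * r)) =
      Real.exp (2 * (1 + k) * r) * Real.exp (m * (2 * r - Real.log lam)) * lam ^ m := by
    rw [e1, ← Real.exp_add, ← Real.exp_add]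
    congr 1
    push_cast
    ring
  rw [e3]
  have : lam ^ m ≠ 0 := by positivity
  rw [div_eq_mul_inv 2, mul_inv, inv_div, div_eq_mul_inv (1 - ρ)]
  field_simp
  ring

theorem ozarowCorner_mem_capacity {P₁ P₂ N : ℝ} (hP₁ : 0 < P₁) (hP₂ : 0 < P₂) (hN : 0 < N) :
    ozarowCorner P₁ P₂ N ∈ perfectFeedbackCapacity P₁ P₂ N := by
  obtain ⟨hc1, hc2, -⟩ := (ozarowCorner_mem_ozarowRegion hP₁ hP₂ hN).1
  refine ⟨hc1, hc2, fun δ hδ ε hε => ?_⟩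
  obtain ⟨hI, he⟩ := rhoStar_spec hP₁ hP₂ hN
  obtain ⟨hρ, hρ1⟩ := rhoEquation_pos_lt_one hP₁ hP₂ hN hI he
  unfold ozarowCorner
  set ρ := rhoStar P₁ P₂ N
  have hτ : 0 < 1 - ρ ^ 2 := by nlinarith
  let P : Fin 2 → ℝ := ![P₁, P₂]
  have hP : ∀ ν, 0 < P ν := Fin.forall_fin_two.2 ⟨hP₁, hP₂⟩
  obtain ⟨k, hk⟩ := exists_code hP hN hρ hρ1 he
  let lam : Fin 2 → ℝ := fun ν => 1 + P ν * (1 - ρ ^ 2) / N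
  have hl1 : ∀ ν, 1 < lam ν := fun ν => by
    have := hP ν
    have : 0 < P ν * (1 - ρ ^ 2) / N := by positivity
    simp only [lam]
    linarith
  have hlp : ∀ ν, 0 < lam ν := fun ν => zero_lt_one.trans (hl1 ν)
  -- Truncation at 0 keeps exp(x·r) ≥ 1, so rounding up to an integer costs at most a factor 2.
  let r : Fin 2 → ℝ := fun ν => max 0 (1 / 2 * Real.log (lam ν) - δ / 2)
  have hr0 : ∀ ν, 0 ≤ r ν := fun ν => le_max_left _ _
  have hr1 : ∀ ν, r ν < 1 / 2 * Real.log (lam ν) := fun ν =>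
    max_lt (by have := Real.log_pos (hl1 ν); linarith) (by linarith)
  have hr2 : ∀ ν, 1 / 2 * Real.log (lam ν) - δ < r ν := fun ν =>
    lt_of_lt_of_le (by linarith) (le_max_right _ _)
  have ev1 : ∀ ν, ∀ᶠ m : ℕ in atTop, 4 / (1 - ρ ^ 2) ≤ lam ν ^ m / (1 - ρ) := fun ν =>
    (tendsto_pow_div_atTop (hl1 ν) hρ1).eventually_ge_atTop _
  have ev2 : ∀ ν, ∀ᶠ m : ℕ in atTop, (2 * Real.exp (((m + 1 + k : ℕ) : ℝ) * r ν)) ^ 2 *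
      (2 / ((1 - ρ ^ 2) * (lam ν ^ m / (1 - ρ)))) < ε / 2 := fun ν =>
    (tendsto_error_bound k (hlp ν) (hr1 ν)).eventually (gt_mem_nhds (by positivity))
  obtain ⟨m₀, hm₀⟩ := eventually_atTop.1 (((ev1 0).and (ev1 1)).and ((ev2 0).and (ev2 1)))
  filter_upwards [eventually_ge_atTop (m₀ + 1 + k)] with n hn
  obtain ⟨m, rfl⟩ : ∃ m, n = m + 1 + k := ⟨n - 1 - k, by omega⟩
  obtain ⟨⟨a0, a1⟩, b0, b1⟩ := hm₀ m (by omega)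
  set x : ℝ := ((m + 1 + k : ℕ) : ℝ) with hx
  have hxp : 0 < x := by rw [hx]; exact_mod_cast (by omega : 0 < m + 1 + k)
  let M : Fin 2 → ℕ := fun ν => ⌈Real.exp (x * r ν)⌉₊
  have hM0 : ∀ ν, 0 < M ν := fun ν => Nat.ceil_pos.2 (Real.exp_pos _)
  obtain ⟨c, p1, p2, c1, c2, herr⟩ := hk m (Fin.forall_fin_two.2 ⟨a0, a1⟩) M hM0
  have hMu : ∀ ν, (M ν : ℝ) ≤ 2 * Real.exp (x * r ν) := fun ν => by
    have h1 := (Nat.ceil_lt_add_one (Real.exp_pos (x * r ν)).le).le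
    have h2 : 1 ≤ Real.exp (x * r ν) := Real.one_le_exp (mul_nonneg hxp.le (hr0 ν))
    simp only [M]
    linarith
  have hMl : ∀ ν, 1 / 2 * Real.log (lam ν) - δ < 1 / x * Real.log (M ν) := fun ν => by
    refine (hr2 ν).trans_le ?_
    have h1 : x * r ν ≤ Real.log (M ν) := by
      rw [Real.le_log_iff_exp_le (by exact_mod_cast hM0 ν)]
      exact Nat.le_ceil _
    rw [one_div, le_inv_mul_iff₀ hxp]
    exact h1
  refine ⟨c, p1, p2, ?_, ?_, ?_⟩
  · rw [c1]
    exact hMl 0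
  · rw [c2]
    exact hMl 1
  · refine herr.trans ?_
    rw [Fin.sum_univ_two]
    have hle : ∀ ν, (M ν : ℝ) ^ 2 * (2 / ((1 - ρ ^ 2) * (lam ν ^ m / (1 - ρ)))) ≤
        (2 * Real.exp (x * r ν)) ^ 2 * (2 / ((1 - ρ ^ 2) * (lam ν ^ m / (1 - ρ)))) := fun ν => by
      have h1 : 0 < 1 - ρ := by linarith
      have := hlp ν
      have := hMu ν
      gcongr
    have := hle 0
    have := hle 1
    simp only [lam] at *
    linarith

end AWGNMAC

end

theorem mainTheorem7 (P₁ P₂ N : ℝ) (hP₁ : 0 < P₁) (hP₂ : 0 < P₂) (hN : 0 < N) :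
    AWGNMAC.ozarowRegion P₁ P₂ N (AWGNMAC.rhoStar P₁ P₂ N) ⊆
      closure (AWGNMAC.vanishingNoiseRegion P₁ P₂ N) ∧
    (AWGNMAC.ozarowCorner P₁ P₂ N ∈ AWGNMAC.perfectFeedbackCapacity P₁ P₂ N ∧
      ∀ R ∈ AWGNMAC.perfectFeedbackCapacity P₁ P₂ N, R ≠ AWGNMAC.ozarowCorner P₁ P₂ N →
        R.1 + R.2 < (AWGNMAC.ozarowCorner P₁ P₂ N).1 + (AWGNMAC.ozarowCorner P₁ P₂ N).2) ∧
    (∀ ε > (0 : ℝ), ∃ σ > (0 : ℝ), ∀ K : Matrix (Fin 2) (Fin 2) ℝ,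
      K.PosSemidef → K.trace ≤ σ ^ 2 →
        ∃ R ∈ AWGNMAC.rateRegion P₁ P₂ N K, dist R (AWGNMAC.ozarowCorner P₁ P₂ N) < ε) :=
  ⟨AWGNMAC.ozarowRegion_subset_closure hP₁ hP₂ hN,
    ⟨AWGNMAC.ozarowCorner_mem_capacity hP₁ hP₂ hN,
      fun _ hR hne => AWGNMAC.sumRate_lt_of_ne_ozarowCorner hP₁ hP₂ hN hR hne⟩,
    fun _ hε => AWGNMAC.exists_mem_rateRegion_near_corner hP₁ hP₂ hN hε⟩
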